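/- **Problem (MCD on a line).** Let $n\ge 2$, let $L(n)$ be the undirected line network with nodes $1,\dots,n$ and let $rot\in\{1,\dots,n\}$ be the origin. The network$\times$time grid has the replicas $(v,t)$, $1\le v\le n$, $t\in\mathbb N$, undirected horizontal edges between $(v,t)$ and $(v+1,t)$, and arcs directed from $(v,t)$ to $(v,t+1)$. A request sequence $\mathcal R=(r_1,\dots,r_N)$, $r_i=(v_i,t_i)$, is a finite sequence of replicas with $t_1\le\dots\le t_N$. A feasible solution is a finite set $F$ of edges of the grid such that every $r_i$ is reached from $(rot,0)$ by a path in $F$; its cost is $|F|$, and $\mathrm{OPT}(\mathcal R)$ is the minimum cost. A deterministic online algorithm sees, for $t=0,1,2,\dots$, the requests of time $t$ one by one and then the end of time $t$. On a request $(v,t)$ it may only add horizontal edges of time $t$ connected to its solution, after which $(v,t)$ has to be reached; at the end of time $t$ it may only add arcs $((w,t),(w,t+1))$ with $(w,t)$ in its solution; edges are never removed. Its cost on $\mathcal R$ is the number of edges added up to and including the end of time $t_N$. **Algorithm LineOn.** For $s\le t$ let $d((u,s),(v,t))=t-s+|u-v|$. Let $\Delta=\lceil\sqrt{10\log_2 n}\,\rceil$.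 For $0\le l\le\lceil\log_2\lceil n/\Delta\rceil\rceil$ (which is $\log_2(n/\Delta)$ if $n/\Delta$ is a power of $2$) and $j\ge1$, the level-$l$ intervals are the nonempty sets among $I^l_j=\{\Delta 2^l(j-1)+k\mid 1\le k\le\Delta2^l\}\cap\{1,\dots,n\}$; the neighborhood $N(I^l_j)$ is the union of $I^l_j$ with the adjacent level-$l$ intervals. LineOn simulates the offline algorithm Triangle, whose solution initially is the replica $(rot,0)$. For each request $r_i=(v_i,t_i)$, Triangle chooses a replica $(u,s)$ of its solution for which $\rho_i=d((u,s),r_i)$ is minimum, adds the vertical path from $(u,s)$ to $(u,t_i)$, and adds all replicas of the base $\mathrm{Base}(i)=\{(w,t_i)\mid 1\le w\le n,\ |w-v_i|\le\rho_i\}$, with the edges between them that close no cycle. Let $\mathrm{Base}$ be the union of all $\mathrm{Base}(i)$ so far, and let $C_0=\{rot\}$ be the set of nodes that hold a copy at the start of time $0$. *Delivery phase of time $t$:* for each request $r_i=(v_i,t)$, choose a node $q$ closest to $v_i$ among $C_t$ and the nodes of the edges already added at time $t$; add the horizontal path between $(q,t)$ and $r_i$ and all horizontal edges between members of $\mathrm{Base}(i)$.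 *Storage phase of time $t$:* let first $C_{t+1}=\{rot\}$. For $l=0,1,2,\dots$ in increasing order: while there is a level-$l$ interval $I$ that contains the node of a replica of $\mathrm{Base}$ of one of the times $t-2^l+1,\dots,t$ and has $C_{t+1}\cap N(I)=\emptyset$, choose such an $I$, choose a node $v\in N(I)$ with $v\in C_t$ or $(v,t)\in\mathrm{Base}$, and add $v$ to $C_{t+1}$. Finally add the arcs $((v,t),(v,t+1))$ for all $v\in C_{t+1}$. **Theorem.** LineOn is $O(\sqrt{\log n})$-competitive for MCD on the undirected line network. That is, there is an absolute constant $K>0$ such that for every $n\ge2$, every origin and every deterministic rule that resolves the choices left open above, LineOn is an online algorithm in the above sense, and for every request sequence $\mathcal R$ its solution is feasible and $$\mathrm{cost}(\mathrm{LineOn},\mathcal R)\le K\sqrt{\log_2 n}\cdot\max\{\mathrm{OPT}(\mathcal R),1\}.$$ (The maximum matters only if $\mathrm{OPT}(\mathcal R)=0$, that is, if all requests are at $(rot,0)$.) -/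

import Mathlib

open Real

namespace MCD

/-! ### The line network, its network-time grid, and the problem -/

/-- A replica `(v, t)`: node `v` at time `t`. The nodes of the line network on `n` nodes are the
numbers `1, ..., n`. -/
abbrev Replica := ℕ × ℕ

/-- `v` is a node of the line network on `n` nodes. -/
def IsNode (n v : ℕ) : Prop := 1 ≤ v ∧ v ≤ n

/-- Edges of the grid: `hor v t` is the undirected horizontal edge between `(v, t)` and
`(v + 1, t)`, and `arc v t` is the arc directed from `(v, t)` to `(v, t + 1)`. -/
inductive Edge where
  | hor (v t : ℕ)
  | arc (v t : ℕ)
  deriving DecidableEq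

/-- The edges of the grid of the line network on `n` nodes. -/
def IsEdge (n : ℕ) : Edge → Prop
  | .hor v _ => IsNode n v ∧ IsNode n (v + 1)
  | .arc v _ => IsNode n v

/-- The network nodes of the two end points of an edge. -/
def Edge.nodes : Edge → Finset ℕ
  | .hor v _ => {v, v + 1}
  | .arc v _ => {v}

/-- One move along an edge of `F`; a horizontal edge may be used in both directions. -/
inductive Move (F : Finset Edge) : Replica → Replica → Prop
  | up (v t : ℕ) : Edge.arc v t ∈ F → Move F (v, t) (v, t + 1)
  | right (v t : ℕ) : Edge.hor v t ∈ F → Move F (v, t) (v + 1, t)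
  | left (v t : ℕ) : Edge.hor v t ∈ F → Move F (v + 1, t) (v, t)

/-- The replica `q` is reached from `p` inside `F`. -/
def Reach (F : Finset Edge) (p q : Replica) : Prop := Relation.ReflTransGen (Move F) p q

/-- Request sequences: replicas of the grid, in nondecreasing order of time. -/
def IsRequestSeq (n : ℕ) (R : List Replica) : Prop :=
  (∀ r ∈ R, IsNode n r.1) ∧ R.Pairwise (fun r r' => r.2 ≤ r'.2)

/-- Feasible solutions: finite sets of grid edges in which every request is reached from the
origin replica `(root, 0)`. The cost of a solution is its number of edges. -/
def Feasible (n root : ℕ) (R : List Replica) (F : Finset Edge) : Prop :=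
  (∀ e ∈ F, IsEdge n e) ∧ ∀ r ∈ R, Reach F (root, 0) r

/-- The optimal (offline) cost. -/
noncomputable def opt (n root : ℕ) (R : List Replica) : ℕ :=
  sInf {k | ∃ F : Finset Edge, Feasible n root R F ∧ F.card = k}

/-! ### The online model -/

/-- Events seen by an online algorithm: a request at a node (at the current time), or the clock
telling that the current time ends and the next one starts. -/
inductive Event where
  | request (v : ℕ)
  | tick
  deriving DecidableEq

/-- The current time after a history of events. -/
def currentTime (h : List Event) : ℕ := h.count Event.tick

/-- All requests of the history are at nodes of the network. -/
def ValidHistory (n : ℕ) (h : List Event) : Prop := ∀ v, Event.request v ∈ h → IsNode n v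

/-- The time of the last request. -/
def lastTime (R : List Replica) : ℕ := (R.map Prod.snd).foldr max 0

/-- The events that present the requests `R`: for each time `t = 0, ..., lastTime R`, the
requests of time `t` in their order, followed by the end of time `t`. -/
def events (R : List Replica) : List Event :=
  (List.range (lastTime R + 1)).flatMap fun t =>
    ((R.filter fun r => r.2 = t).map fun r => Event.request r.1) ++ [Event.tick]

/-- A deterministic online strategy: the set of edges bought after each history of events. -/
abbrev Strategy := List Event → Finset Edge

/-- The rules of the online problem. Bought edges are never removed. When a request `v` arrives
at time `t`, only horizontal edges of time `t`, connected to the solution, may be added, and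
`(v, t)` has to be in the solution afterwards. When time `t` ends, only arcs leaving time-`t`
replicas that are in the solution may be added. -/
structure IsOnlineAlgorithm (n root : ℕ) (A : Strategy) : Prop where
  start : A [] = ∅
  mono : ∀ h e, ValidHistory n (h ++ [e]) → A h ⊆ A (h ++ [e])
  request : ∀ h v, ValidHistory n (h ++ [.request v]) →
    Reach (A (h ++ [.request v])) (root, 0) (v, currentTime h) ∧
    ∀ e ∈ A (h ++ [.request v]) \ A h, ∃ w, e = .hor w (currentTime h) ∧ IsEdge n e ∧
      Reach (A (h ++ [.request v])) (root, 0) (w, currentTime h)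
  tick : ∀ h, ValidHistory n h →
    ∀ e ∈ A (h ++ [.tick]) \ A h, ∃ w, e = .arc w (currentTime h) ∧ IsEdge n e ∧
      Reach (A h) (root, 0) (w, currentTime h)

/-- The strategy `A` is `c`-competitive: it always produces a feasible solution, of cost at most
`c` times the optimal cost. The maximum with `1` matters only if the optimal cost is `0`, that is,
if every request is at the origin at time `0`. -/
def IsCompetitive (n root : ℕ) (A : Strategy) (c : ℝ) : Prop :=
  ∀ R : List Replica, IsRequestSeq n R →
    Feasible n root R (A (events R)) ∧
    ((A (events R)).card : ℝ) ≤ c * (max (opt n root R) 1 : ℕ)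

/-! ### Intervals -/

/-- The `j`-th interval of level `l`, namely `{Δ 2^l (j-1) + k | 1 ≤ k ≤ Δ 2^l}`, cut to the node
set `{1, ..., n}`. It is empty for `j = 0` and for `j` larger than the number of intervals. -/
def interval (n Δ l j : ℕ) : Finset ℕ :=
  (Finset.Icc 1 n).filter fun v => v ≤ Δ * 2 ^ l * j ∧ Δ * 2 ^ l * j < v + Δ * 2 ^ l

/-- The neighborhood of an interval: the interval with its left and right neighbors, if any. -/
def neighborhood (n Δ l j : ℕ) : Finset ℕ :=
  interval n Δ l (j - 1) ∪ interval n Δ l j ∪ interval n Δ l (j + 1)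

/-- The highest level: the least `L` with `n ≤ Δ 2^L`; it is `log₂ (n / Δ)` if `n / Δ` is a power
of `2`. -/
def topLevel (n Δ : ℕ) : ℕ := Nat.clog 2 (n ⌈/⌉ Δ)

/-- The `j`-th interval of level `l` is stay-active at time `t`: it contains the node of a base
replica of one of the times `t - 2^l + 1, ..., t`. -/
def StayActive (n Δ : ℕ) (base : Finset Replica) (t l j : ℕ) : Prop :=
  ∃ p ∈ base, p.1 ∈ interval n Δ l j ∧ p.2 ≤ t ∧ t < p.2 + 2 ^ l

instance (n Δ : ℕ) (base : Finset Replica) (t l j : ℕ) : Decidable (StayActive n Δ base t l j) :=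
  inferInstanceAs (Decidable (∃ p ∈ base, _))

/-! ### The online algorithm -/

/-- The distance from `p` to `r`, used for `p.2 ≤ r.2` only. -/
def dist (p r : Replica) : ℕ := (r.2 - p.2) + Nat.dist p.1 r.1

/-- The replicas of `S` from which the distance to `r` is smallest. -/
def closest (S : Finset Replica) (r : Replica) : Finset Replica :=
  S.filter fun p => p.2 ≤ r.2 ∧ ∀ p' ∈ S, p'.2 ≤ r.2 → dist p r ≤ dist p' r

/-- The nodes of `S` closest to the node `v`. -/
def closestNodes (S : Finset ℕ) (v : ℕ) : Finset ℕ :=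
  S.filter fun u => ∀ u' ∈ S, Nat.dist u v ≤ Nat.dist u' v

/-- The algorithm leaves four choices open; a value of this type resolves all of them, in
an arbitrary deterministic way that may depend on the history and the state of the computation.
The last argument is always the set of admissible candidates. -/
structure TieBreaking where
  /-- the serving replica of the simulated offline algorithm -/
  offline : List Event → Finset Replica → Replica
  offline_mem : ∀ h s, s.Nonempty → offline h s ∈ s
  /-- the node from which a request is served online -/
  serve : List Event → Finset ℕ → ℕ
  serve_mem : ∀ h s, s.Nonempty → serve h s ∈ s
  /-- the next interval to commit; arguments: history, level, nodes stored so far -/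
  commit : List Event → ℕ → Finset ℕ → Finset ℕ → ℕ
  commit_mem : ∀ h l c s, s.Nonempty → commit h l c s ∈ s
  /-- the node to store a copy for a committing interval; arguments: history, level, nodes stored
  so far, index of the interval -/
  store : List Event → ℕ → Finset ℕ → ℕ → Finset ℕ → ℕ
  store_mem : ∀ h l c j s, s.Nonempty → store h l c j s ∈ s

/-- The state of the algorithm. -/
structure State where
  /-- the events so far -/
  hist : List Event
  /-- the current time `t` -/
  time : ℕ
  /-- the replicas in the solution of the simulated offline algorithm -/
  offline : Finset Replica
  /-- the base replicas of all requests so far -/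
  base : Finset Replica
  /-- the nodes that stored a copy from time `t - 1` to time `t` -/
  cache : Finset ℕ
  /-- the nodes of `cache` and of the end points of the edges added at time `t` -/
  copies : Finset ℕ
  /-- the online solution: all edges added so far -/
  sol : Finset Edge

/-- The horizontal edges of the path between `(a, t)` and `(b, t)`. -/
def pathEdges (a b t : ℕ) : Finset Edge :=
  (Finset.Ico (min a b) (max a b)).image fun w => Edge.hor w t

/-- The nodes at distance at most `ρ` from `v`. -/
def baseNodes (n v ρ : ℕ) : Finset ℕ := (Finset.Icc 1 n).filter fun w => Nat.dist w v ≤ ρ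

/-- The horizontal edges of time `t` between nodes at distance at most `ρ` from `v`. -/
def baseEdges (n v ρ t : ℕ) : Finset Edge :=
  ((baseNodes n v ρ).filter fun w => w + 1 ∈ baseNodes n v ρ).image fun w => Edge.hor w t

/-- Delivery phase for one request at node `v` at the current time `t`.
Simulation of the offline algorithm: choose a replica `q = (u, s)` of the offline solution from
which the distance `ρ` to `(v, t)` is smallest, add the vertical path from `(u, s)` to `(u, t)` and
the base, that is, all replicas of time `t` at distance at most `ρ`. (The offline algorithm omits
base edges that would close a cycle; this does not change the set of its replicas, which is all
that is needed.)
Then deliver online: choose a closest copy at time `t`, and add the path from it to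
`(v, t)` and all edges of the base. -/
def deliver (n : ℕ) (σ : TieBreaking) (s : State) (v : ℕ) : State :=
  let t := s.time
  let h := s.hist ++ [Event.request v]
  let q := σ.offline h (closest s.offline (v, t))
  let ρ := dist q (v, t)
  let newBase := (baseNodes n v ρ).image fun w => (w, t)
  let u := σ.serve h (closestNodes s.copies v)
  let P := pathEdges u v t ∪ baseEdges n v ρ t
  { hist := h
    time := t
    offline := s.offline ∪ (Finset.Icc q.2 t).image (fun z => (q.1, z)) ∪ newBase
    base := s.base ∪ newBase
    cache := s.cache
    copies := s.copies ∪ P.biUnion Edge.nodes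
    sol := s.sol ∪ P }

/-- The stay-active intervals of level `l` (given by their indices) without a stored copy in their
neighborhood, where `C` is the set of nodes selected so far to store a copy. -/
def pending (n Δ : ℕ) (base : Finset Replica) (t l : ℕ) (C : Finset ℕ) : Finset ℕ :=
  (Finset.range (n + 1)).filter fun j =>
    StayActive n Δ base t l j ∧ Disjoint C (neighborhood n Δ l j)

/-- The nodes with a copy, among those of `cache` and of base replicas of the current time, that
lie in the neighborhood of an interval. -/
def storeCandidates (n Δ : ℕ) (s : State) (l j : ℕ) : Finset ℕ :=
  (s.cache ∪ (s.base.filter fun p => p.2 = s.time).image Prod.fst) ∩ neighborhood n Δ l j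

theorem pending_card_lt (n Δ : ℕ) (base : Finset Replica) (t l : ℕ) (C : Finset ℕ) (j v : ℕ)
    (hj : j ∈ pending n Δ base t l C) (hv : v ∈ neighborhood n Δ l j) :
    (pending n Δ base t l (insert v C)).card < (pending n Δ base t l C).card := by
  apply Finset.card_lt_card
  rw [Finset.ssubset_iff_of_subset]
  · refine ⟨j, hj, fun h => ?_⟩
    have h2 := (Finset.mem_filter.1 h).2.2
    exact Finset.disjoint_left.1 h2 (Finset.mem_insert_self v C) hv
  · intro i hi
    obtain ⟨h1, h2, h3⟩ := Finset.mem_filter.1 hi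
    exact Finset.mem_filter.2 ⟨h1, h2, h3.mono_left (Finset.subset_insert v C)⟩

/-- The loop of the storage phase for level `l`: while some interval of level `l` is pending, choose
one and choose a node with a copy in its neighborhood to be added to `C`. -/
def storeLevel (n Δ : ℕ) (σ : TieBreaking) (s : State) (l : ℕ) (C : Finset ℕ) : Finset ℕ :=
  if hp : (pending n Δ s.base s.time l C).Nonempty then
    let j := σ.commit (s.hist ++ [Event.tick]) l C (pending n Δ s.base s.time l C)
    if hc : (storeCandidates n Δ s l j).Nonempty then
      storeLevel n Δ σ s l
        (insert (σ.store (s.hist ++ [Event.tick]) l C j (storeCandidates n Δ s l j)) C)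
    else C
  else C
termination_by (pending n Δ s.base s.time l C).card
decreasing_by
  exact pending_card_lt _ _ _ _ _ _ _ _ (σ.commit_mem _ _ _ _ hp)
    (Finset.mem_inter.1 (σ.store_mem _ _ _ _ _ hc)).2

/-- The nodes selected in the storage phase: first the origin, then the levels in increasing
order. -/
def nextCache (n Δ root : ℕ) (σ : TieBreaking) (s : State) : Finset ℕ :=
  (List.range (topLevel n Δ + 1)).foldl (fun C l => storeLevel n Δ σ s l C) {root}

/-- Storage phase at the end of the current time. -/
def store (n Δ root : ℕ) (σ : TieBreaking) (s : State) : State :=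
  let C := nextCache n Δ root σ s
  { hist := s.hist ++ [Event.tick]
    time := s.time + 1
    offline := s.offline
    base := s.base
    cache := C
    copies := C
    sol := s.sol ∪ C.image fun v => Edge.arc v s.time }

/-- The initial state: only the origin has a copy. -/
def initial (root : ℕ) : State where
  hist := []
  time := 0
  offline := {(root, 0)}
  base := ∅
  cache := {root}
  copies := {root}
  sol := ∅

/-- Reaction of the algorithm to one event. -/
def step (n Δ root : ℕ) (σ : TieBreaking) (s : State) : Event → State
  | .request v => deliver n σ s v
  | .tick => store n Δ root σ s

/-- The online algorithm `LineOn` with parameter `Δ`, as a strategy. -/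
def lineOn (n Δ root : ℕ) (σ : TieBreaking) : Strategy := fun h =>
  (h.foldl (step n Δ root σ) (initial root)).sol

/-- The value of the parameter: `√(10 log₂ n)`, rounded up. -/
noncomputable def delta (n : ℕ) : ℕ := ⌈√(10 * logb 2 n)⌉₊

end MCD

/-! The cost of LineOn splits into delivery edges and storage arcs; both are compared with an
arbitrary feasible solution `F`, and finally with an optimal one.

Delivery. Any path to a request traverses all distance levels below its radius ρ, so `F` has at
least ρ edges in the backward ball of radius ρ. Since Triangle serves each request from a nearest
replica, these balls have disjoint edge sets, and the radii sum to at most `F.card`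
(`sum_radius_le_card`). The storage rule keeps a copy within O(Δρ) of each request
(`exists_copy_dist_le`), so deliveries cost O(Δ) · `F.card`.

Storage. The origin costs one arc per time step, and the last request time is at most `F.card`.
Every other arc is paid by a commitment of an interval of length D = Δ2^l, and these are of three
kinds. (1) Some witnessing request has radius at least D/8. A request of radius ρ witnesses O(ρ/Δ)
of these per level (`mul_card_big_le`). (2) `F` has an arc near the interval at the time of the
commitment. Commitments of one time near the same node occupy at most two consecutive levels, so
each arc is charged at most 6 times (`card_arc_le`). (3) Neither holds. The witnessing request is
then well inside the surroundings of the interval and the origin is outside, so `F` crossed at least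
D/8 horizontal edges on its last entrance (`len_le_card_charged`). It stayed nearby until the
request but has no nearby arc at the time of the commitment, which confines the commitments charging
one edge to a window of 2^l times (`card_charging_le`). Hence O(`F.card`/Δ) per level.

With L + 1 levels the total is O(Δ + (L + 1)/Δ) · `F.card`, up to an additive constant. Since L + 1
= O(log n), taking Δ of order √(log n) balances the two terms. -/

namespace MCD

/-! ### Paths in the grid -/

theorem Move.mono {F G : Finset Edge} (h : F ⊆ G) {p q : Replica} (m : Move F p q) :
    Move G p q := by
  cases m with
  | up v t e => exact .up v t (h e)
  | right v t e => exact .right v t (h e)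
  | left v t e => exact .left v t (h e)

theorem Reach.mono {F G : Finset Edge} (h : F ⊆ G) {p q : Replica} (m : Reach F p q) :
    Reach G p q :=
  Relation.ReflTransGen.mono (fun _ _ => Move.mono h) _ _ m

theorem reach_right {F : Finset Edge} {a t : ℕ} (k : ℕ)
    (h : ∀ x, a ≤ x → x < a + k → Edge.hor x t ∈ F) : Reach F (a, t) (a + k, t) := by
  induction k with
  | zero => exact .refl
  | succ k ih =>
    exact (ih fun x h1 h2 => h x h1 (by omega)).tail (.right _ _ (h _ (by omega) (by omega)))

theorem reach_left {F : Finset Edge} {a t : ℕ} (k : ℕ)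
    (h : ∀ x, a ≤ x → x < a + k → Edge.hor x t ∈ F) : Reach F (a + k, t) (a, t) := by
  induction k with
  | zero => exact .refl
  | succ k ih =>
    exact (ih fun x h1 h2 => h x h1 (by omega)).head (.left _ _ (h (a + k) (by omega) (by omega)))

theorem reach_row {F : Finset Edge} {a b t : ℕ}
    (h : ∀ x, min a b ≤ x → x < max a b → Edge.hor x t ∈ F) : Reach F (a, t) (b, t) := by
  rcases le_total a b with hab | hab
  · obtain ⟨k, rfl⟩ := Nat.exists_eq_add_of_le hab
    exact reach_right k fun x h1 h2 => h x (by omega) (by omega)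
  · obtain ⟨k, rfl⟩ := Nat.exists_eq_add_of_le hab
    exact reach_left k fun x h1 h2 => h x (by omega) (by omega)

/-! ### Packing balls into a feasible solution -/

/-- The end point of an edge that is left or earlier. -/
def Edge.fst : Edge → Replica
  | .hor v t => (v, t)
  | .arc v t => (v, t)

/-- The end point of an edge that is right or later. -/
def Edge.snd : Edge → Replica
  | .hor v t => (v + 1, t)
  | .arc v t => (v, t + 1)

/-- Along `e` the distance to `r` changes between `k` and `k + 1`. -/
def Descends (r : Replica) (k : ℕ) (e : Edge) : Prop :=
  e.fst.2 ≤ r.2 ∧ e.snd.2 ≤ r.2 ∧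
    ((dist e.fst r = k + 1 ∧ dist e.snd r = k) ∨ (dist e.snd r = k + 1 ∧ dist e.fst r = k))

/-- A move changes the distance to `r` by exactly one, as long as its ends are not later than `r`.
The distance falls to 0 along the path, so every level below the initial distance is crossed. -/
theorem Reach.exists_descends {F : Finset Edge} {p r : Replica} (h : Reach F p r) :
    p.2 ≤ r.2 ∧ ∀ k < dist p r, ∃ e ∈ F, Descends r k e := by
  induction h using Relation.ReflTransGen.head_induction_on with
  | refl => exact ⟨le_rfl, fun k hk => by simp [dist] at hk⟩
  | head m _ ih =>
    obtain ⟨h1, h2⟩ := ih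
    obtain ⟨rv, rt⟩ := r
    cases m with
    | up v t e =>
      simp only at h1
      refine ⟨by simp only; omega, fun k hk => ?_⟩
      by_cases hk' : k < dist (v, t + 1) (rv, rt)
      · exact h2 k hk'
      · refine ⟨_, e, ?_⟩
        simp only [Descends, Edge.fst, Edge.snd, dist, Nat.dist] at *
        omega
    | right v t e =>
      simp only at h1
      refine ⟨by simp only; omega, fun k hk => ?_⟩
      by_cases hk' : k < dist (v + 1, t) (rv, rt)
      · exact h2 k hk'
      · refine ⟨_, e, ?_⟩
        simp only [Descends, Edge.fst, Edge.snd, dist, Nat.dist] at *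
        omega
    | left v t e =>
      simp only at h1
      refine ⟨by simp only; omega, fun k hk => ?_⟩
      by_cases hk' : k < dist (v, t) (rv, rt)
      · exact h2 k hk'
      · refine ⟨_, e, ?_⟩
        simp only [Descends, Edge.fst, Edge.snd, dist, Nat.dist] at *
        omega

open Classical in
/-- The edges of `F` inside the ball of radius `ρ` that ends in `r`. -/
noncomputable def ballEdges (F : Finset Edge) (r : Replica) (ρ : ℕ) : Finset Edge :=
  F.filter fun e => ∃ k < ρ, Descends r k e

theorem ballEdges_subset (F : Finset Edge) (r : Replica) (ρ : ℕ) : ballEdges F r ρ ⊆ F := by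
  classical
  exact Finset.filter_subset _ _

/-- An edge determines the level that it crosses, so edges chosen for different levels are
different. -/
theorem Reach.le_card_ballEdges {F : Finset Edge} {p r : Replica} (h : Reach F p r) {ρ : ℕ}
    (hρ : ρ ≤ dist p r) : ρ ≤ (ballEdges F r ρ).card := by
  classical
  have h2 := h.exists_descends.2
  have : ∀ k : Fin ρ, ∃ e ∈ F, Descends r k e := fun k => h2 k (by omega)
  choose f hf hd using this
  have := Finset.card_le_card_of_injOn (s := (Finset.univ : Finset (Fin ρ)))
    (t := ballEdges F r ρ) f
    (fun k _ => by
      simp only [ballEdges, Finset.coe_filter, Set.mem_ofPred_eq]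
      exact ⟨hf k, k, k.2, hd k⟩)
    (fun a _ b _ hab => by
      have ha := hd a
      have hb := hd b
      rw [hab] at ha
      obtain ⟨-, -, ha⟩ := ha
      obtain ⟨-, -, hb⟩ := hb
      ext
      omega)
  simpa using this

/-- The time of a reached replica is at most the number of edges. -/
theorem Reach.time_le_card {F : Finset Edge} {a v t : ℕ} (h : Reach F (a, 0) (v, t)) :
    t ≤ F.card :=
  (h.le_card_ballEdges (ρ := t) (by simp [dist])).trans
    (Finset.card_le_card (ballEdges_subset _ _ _))

theorem isNode_of_isEdge {n : ℕ} {e : Edge} (h : IsEdge n e) :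
    IsNode n e.fst.1 ∧ IsNode n e.snd.1 := by
  cases e with
  | hor v t => exact h
  | arc v t => exact ⟨h, h⟩

/-- `(r', ρ')` respects `(r, ρ)`: it comes later and the base of radius `ρ` around `r` has distance
at least `ρ'` from `r'`. -/
def Respects (n : ℕ) (a b : Replica × ℕ) : Prop :=
  a.1.2 ≤ b.1.2 ∧ ∀ x, IsNode n x → Nat.dist x a.1.1 ≤ a.2 → b.2 ≤ dist (x, a.1.2) b.1

/-- Both ends of an edge in the ball of `a` have distance at least `b.2` from `b.1`, whereas an edge
in the ball of `b` has an end at distance less than `b.2`. -/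
theorem disjoint_ballEdges {n : ℕ} {F : Finset Edge} (hF : ∀ e ∈ F, IsEdge n e)
    {a b : Replica × ℕ} (h : Respects n a b) :
    Disjoint (ballEdges F a.1 a.2) (ballEdges F b.1 b.2) := by
  classical
  rw [Finset.disjoint_left]
  intro e he he'
  simp only [ballEdges, Finset.mem_filter] at he he'
  obtain ⟨hFe, k, hk, h1, h2, hd⟩ := he
  obtain ⟨-, k', hk', h1', h2', hd'⟩ := he'
  obtain ⟨hn1, hn2⟩ := isNode_of_isEdge (hF e hFe)
  obtain ⟨ht, h⟩ := h
  -- Moving `p` up its column to the time of `a` lands in the base of `a` and does not increase the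
  -- distance to `b.1`.
  have key : ∀ p : Replica, IsNode n p.1 → p.2 ≤ a.1.2 → dist p a.1 ≤ a.2 →
      b.2 ≤ dist p b.1 := by
    intro p hp hp2 hpd
    refine (h p.1 hp ?_).trans ?_
    · simp only [dist] at hpd; omega
    · simp only [dist]; omega
  have := key _ hn1 h1
  have := key _ hn2 h2
  omega

/-- Balls that respect each other need disjoint sets of edges. -/
theorem sum_radius_le_card {n : ℕ} {F : Finset Edge} (hF : ∀ e ∈ F, IsEdge n e) {o : Replica}
    (T : List (Replica × ℕ)) (hT : T.Pairwise (Respects n))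
    (hr : ∀ a ∈ T, Reach F o a.1 ∧ a.2 ≤ dist o a.1) : (T.map Prod.snd).sum ≤ F.card := by
  classical
  -- The induction also records that `S` is covered by the balls of the list, so that a further ball
  -- is disjoint from it.
  have : ∃ S : Finset Edge, S ⊆ F ∧ (T.map Prod.snd).sum ≤ S.card ∧
      ∀ e ∈ S, ∃ a ∈ T, e ∈ ballEdges F a.1 a.2 := by
    induction T with
    | nil => exact ⟨∅, by simp⟩
    | cons a T ih =>
      rw [List.pairwise_cons] at hT
      obtain ⟨S, hS1, hS2, hS3⟩ := ih hT.2 fun b hb => hr b (List.mem_cons_of_mem _ hb)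
      refine ⟨ballEdges F a.1 a.2 ∪ S,
        Finset.union_subset (ballEdges_subset _ _ _) hS1, ?_, ?_⟩
      · rw [Finset.card_union_of_disjoint]
        · have := hr a List.mem_cons_self
          have := this.1.le_card_ballEdges this.2
          simp only [List.map_cons, List.sum_cons]
          omega
        · rw [Finset.disjoint_left]
          intro e he he'
          obtain ⟨b, hb, hbe⟩ := hS3 e he'
          exact Finset.disjoint_left.1 (disjoint_ballEdges hF (hT.1 b hb)) he hbe
      · intro e he
        rcases Finset.mem_union.1 he with he | he
        · exact ⟨a, List.mem_cons_self, he⟩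
        · obtain ⟨b, hb, hbe⟩ := hS3 e he
          exact ⟨b, List.mem_cons_of_mem _ hb, hbe⟩
  obtain ⟨S, h1, h2, -⟩ := this
  exact h2.trans (Finset.card_le_card h1)

/-- A path from outside `M` to a replica inside `M` crosses, after its last entrance to `M`, all
positions between a node outside `M` and its end, and meanwhile uses arcs in `M`. -/
theorem Reach.exists_crossing {F : Finset Edge} {M : ℕ → Prop} {o p : Replica}
    (h : Reach F o p) (ho : ¬ M o.1) (hp : M p.1) :
    ∃ y, ¬ M y ∧ ∀ x, min y p.1 ≤ x → x < max y p.1 → (M x ∨ M (x + 1)) ∧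
      ∃ τ ≤ p.2, Edge.hor x τ ∈ F ∧
        ∀ τ', τ ≤ τ' → τ' < p.2 → ∃ z, M z ∧ Edge.arc z τ' ∈ F := by
  induction h with
  | refl => exact absurd hp ho
  | tail _ m ih =>
    cases m with
    | up v t e =>
      obtain ⟨y, hy, hx⟩ := ih hp
      refine ⟨y, hy, fun x h1 h2 => ?_⟩
      obtain ⟨hM, τ, hτ, hF, harc⟩ := hx x h1 h2
      refine ⟨hM, τ, Nat.le_succ_of_le hτ, hF, fun τ' h3 h4 => ?_⟩
      simp only at h4 harc hp
      by_cases h5 : τ' < t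
      · exact harc τ' h3 h5
      · obtain rfl : τ' = t := by omega
        exact ⟨v, hp, e⟩
    | right v t e =>
      by_cases hv : M v
      · obtain ⟨y, hy, hx⟩ := ih hv
        refine ⟨y, hy, fun x h1 h2 => ?_⟩
        simp only at h1 h2 hx
        by_cases hxv : x = v
        · subst hxv
          exact ⟨.inl hv, t, le_rfl, e, fun τ' _ _ => by simp only at *; omega⟩
        · exact hx x (by omega) (by omega)
      -- The move itself enters `M`, so the crossing restarts here and consists of this edge alone.
      · refine ⟨v, hv, fun x h1 h2 => ?_⟩
        simp only at h1 h2 hp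
        obtain rfl : x = v := by omega
        exact ⟨.inr hp, t, le_rfl, e, fun τ' _ _ => by simp only at *; omega⟩
    | left v t e =>
      by_cases hv : M (v + 1)
      · obtain ⟨y, hy, hx⟩ := ih hv
        refine ⟨y, hy, fun x h1 h2 => ?_⟩
        simp only at h1 h2 hx hp
        by_cases hxv : x = v
        · subst hxv
          exact ⟨.inl hp, t, le_rfl, e, fun τ' _ _ => by simp only at *; omega⟩
        · exact hx x (by omega) (by omega)
      · refine ⟨v + 1, hv, fun x h1 h2 => ?_⟩
        simp only at h1 h2 hp
        obtain rfl : x = v := by omega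
        exact ⟨.inl hp, t, le_rfl, e, fun τ' _ _ => by simp only at *; omega⟩

/-! ### Intervals and neighborhoods -/

theorem mem_interval {n Δ l j v : ℕ} :
    v ∈ interval n Δ l j ↔ IsNode n v ∧ v ≤ Δ * 2 ^ l * j ∧ Δ * 2 ^ l * j < v + Δ * 2 ^ l := by
  simp [interval, IsNode]

theorem pos_of_mem_interval {n Δ l j v : ℕ} (h : v ∈ interval n Δ l j) : 1 ≤ j := by
  obtain ⟨h1, h2, -⟩ := mem_interval.1 h
  rcases Nat.eq_zero_or_pos j with rfl | hj
  · simp only [mul_zero] at h2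
    have := h1.1
    omega
  · exact hj

theorem le_of_mem_interval {n Δ l j v : ℕ} (hΔ : 0 < Δ) (h : v ∈ interval n Δ l j) : j ≤ n := by
  obtain ⟨h1, h2, h3⟩ := mem_interval.1 h
  have hD : 0 < Δ * 2 ^ l := by positivity
  have := pos_of_mem_interval h
  obtain ⟨k, rfl⟩ := Nat.exists_eq_add_of_le' this
  have h4 : k ≤ Δ * 2 ^ l * k := Nat.le_mul_of_pos_left k hD
  have := h1.2
  rw [mul_add, mul_one] at h3
  omega

theorem mem_neighborhood {n Δ l j v : ℕ} (hΔ : 0 < Δ) (hj : 1 ≤ j) :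
    v ∈ neighborhood n Δ l j ↔
      IsNode n v ∧ Δ * 2 ^ l * j < v + 2 * (Δ * 2 ^ l) ∧ v ≤ Δ * 2 ^ l * j + Δ * 2 ^ l := by
  have hD : 0 < Δ * 2 ^ l := by positivity
  obtain ⟨k, rfl⟩ := Nat.exists_eq_add_of_le' hj
  simp only [neighborhood, Finset.mem_union, mem_interval, mul_add, mul_one,
    Nat.add_sub_cancel]
  generalize hE : Δ * 2 ^ l * k = E
  generalize Δ * 2 ^ l = D at *
  have : E = 0 ∨ D ≤ E := by
    rcases Nat.eq_zero_or_pos k with rfl | hk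
    · left; simpa using hE.symm
    · right; rw [← hE]; exact Nat.le_mul_of_pos_right D hk
  constructor
  · rintro ((h | h) | h)
    · exact ⟨h.1, by omega⟩
    · exact ⟨h.1, by omega⟩
    · exact ⟨h.1, by omega⟩
  · rintro ⟨h1, h2⟩
    simp only [h1, true_and]
    have := h1.1
    omega

theorem interval_subset_neighborhood (n Δ l j : ℕ) : interval n Δ l j ⊆ neighborhood n Δ l j :=
  fun _ h => Finset.mem_union_left _ (Finset.mem_union_right _ h)

theorem exists_mem_interval {n Δ v : ℕ} (l : ℕ) (hΔ : 0 < Δ) (hv : IsNode n v) :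
    ∃ j, v ∈ interval n Δ l j := by
  have hD : 0 < Δ * 2 ^ l := by positivity
  refine ⟨(v - 1) / (Δ * 2 ^ l) + 1, mem_interval.2 ⟨hv, ?_⟩⟩
  have h1 := Nat.div_add_mod (v - 1) (Δ * 2 ^ l)
  have h2 := Nat.mod_lt (v - 1) hD
  have := hv.1
  rw [mul_add, mul_one]
  omega

theorem dist_lt_of_mem_neighborhood {n Δ l j u v : ℕ} (hΔ : 0 < Δ) (hu : u ∈ interval n Δ l j)
    (hv : v ∈ neighborhood n Δ l j) : Nat.dist v u < 2 * (Δ * 2 ^ l) := by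
  have := mem_interval.1 hu
  have := (mem_neighborhood hΔ (pos_of_mem_interval hu)).1 hv
  simp only [Nat.dist]
  omega

/-- A single top-level interval covers the line; beyond this level the copy at the origin is close
enough to every node. -/
theorem le_topLevel (n Δ : ℕ) (hΔ : 0 < Δ) : n ≤ Δ * 2 ^ topLevel n Δ := by
  have h1 : n ⌈/⌉ Δ ≤ 2 ^ topLevel n Δ := Nat.le_pow_clog (by norm_num) _
  exact (ceilDiv_le_iff_le_mul hΔ).1 h1

/-- `x` lies in the interval `(D (j - 1), D j]` widened by `D / 4` on both sides. -/
def Near (D j x : ℕ) : Prop := 4 * (D * j) < 4 * x + 5 * D ∧ 4 * x ≤ 4 * (D * j) + D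

theorem mem_neighborhood_of_near {n Δ l j x : ℕ} (hΔ : 0 < Δ) (hj : 1 ≤ j) (hx : IsNode n x)
    (h : Near (Δ * 2 ^ l) j x) : x ∈ neighborhood n Δ l j := by
  rw [mem_neighborhood hΔ hj]
  obtain ⟨h1, h2⟩ := h
  have hD : 0 < Δ * 2 ^ l := by positivity
  exact ⟨hx, by omega, by omega⟩

/-- The indices of the level-`l` intervals that are close to `x`. -/
def nearIndices (D x : ℕ) : Finset ℕ := Finset.Icc (x / D) (x / D + 2)

theorem card_nearIndices (D x : ℕ) : (nearIndices D x).card = 3 := by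
  simp only [nearIndices, Nat.card_Icc]
  omega

/-- With q = x / D, the margin D / 4 leaves only the indices q, q + 1, q + 2. Admitting `x + 1`
covers horizontal edges of which only the right end is near. -/
theorem mem_nearIndices {D j x : ℕ} (hD : 0 < D) (h : Near D j x ∨ Near D j (x + 1)) :
    j ∈ nearIndices D x := by
  simp only [Near] at h
  have h1 := Nat.div_add_mod x D
  have h2 := Nat.mod_lt x hD
  rw [nearIndices, Finset.mem_Icc]
  set q := x / D
  constructor
  · by_contra hc
    have : D * (j + 1) ≤ D * q := Nat.mul_le_mul_left D (by omega)
    rw [mul_add, mul_one] at this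
    omega
  · by_contra hc
    have : D * (q + 3) ≤ D * j := Nat.mul_le_mul_left D (by omega)
    rw [mul_add] at this
    omega

/-- If `x` is close to an interval of a level at least two lower, then the neighborhood of that
interval is covered. -/
theorem neighborhood_subset_of_near {n Δ l l' j j' x : ℕ} (hΔ : 0 < Δ) (hj : 1 ≤ j) (hj' : 1 ≤ j')
    (hl : l' + 2 ≤ l) (h : Near (Δ * 2 ^ l) j x) (h' : Near (Δ * 2 ^ l') j' x) :
    neighborhood n Δ l' j' ⊆ neighborhood n Δ l j := by
  intro v hv
  rw [mem_neighborhood hΔ hj'] at hv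
  rw [mem_neighborhood hΔ hj]
  have : 4 * (Δ * 2 ^ l') ≤ Δ * 2 ^ l := by
    calc 4 * (Δ * 2 ^ l') = Δ * 2 ^ (l' + 2) := by ring
      _ ≤ _ := Nat.mul_le_mul_left _ (Nat.pow_le_pow_right (by norm_num) hl)
  simp only [Near] at h h'
  obtain ⟨h1, h2⟩ := hv
  exact ⟨h1, by omega, by omega⟩

/-! ### The storage phase -/

theorem mem_pending {n Δ : ℕ} (hΔ : 0 < Δ) {base : Finset Replica} {t l : ℕ} {C : Finset ℕ}
    {j : ℕ} : j ∈ pending n Δ base t l C ↔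
      StayActive n Δ base t l j ∧ Disjoint C (neighborhood n Δ l j) := by
  rw [pending, Finset.mem_filter, Finset.mem_range]
  refine ⟨fun h => h.2, fun h => ⟨?_, h⟩⟩
  obtain ⟨p, -, hp, -⟩ := h.1
  have := le_of_mem_interval hΔ hp
  omega

/-- The copies available at the end of the current time. -/
def State.available (s : State) : Finset ℕ :=
  s.cache ∪ (s.base.filter fun p => p.2 = s.time).image Prod.fst

/-- Every stay-active interval has a candidate in its neighborhood. -/
def State.Supplied (n Δ : ℕ) (s : State) : Prop :=
  ∀ l ≤ topLevel n Δ, ∀ j, StayActive n Δ s.base s.time l j → (storeCandidates n Δ s l j).Nonempty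

/-- `J` collects the intervals that commit, one for each iteration. By `hs` the loop never stops for
want of a candidate. Disjointness from the initial `C` is what later separates these intervals from
the commitments of lower levels. -/
theorem storeLevel_spec (n Δ : ℕ) (hΔ : 0 < Δ) (σ : TieBreaking) (s : State) (l : ℕ)
    (hs : ∀ j, StayActive n Δ s.base s.time l j → (storeCandidates n Δ s l j).Nonempty)
    (C : Finset ℕ) :
    C ⊆ storeLevel n Δ σ s l C ∧
    storeLevel n Δ σ s l C ⊆ C ∪ s.available ∧
    (∀ j, StayActive n Δ s.base s.time l j →
      ∃ v ∈ storeLevel n Δ σ s l C, v ∈ neighborhood n Δ l j) ∧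
    ∃ J : Finset ℕ, (storeLevel n Δ σ s l C).card ≤ C.card + J.card ∧
      ∀ j ∈ J, StayActive n Δ s.base s.time l j ∧ Disjoint C (neighborhood n Δ l j) ∧
        ∃ v ∈ storeLevel n Δ σ s l C, v ∈ neighborhood n Δ l j := by
  induction hc : (pending n Δ s.base s.time l C).card using Nat.strong_induction_on
    generalizing C with
  | _ c ih =>
    subst hc
    rw [storeLevel]
    split_ifs with hp
    · have hj := σ.commit_mem (s.hist ++ [Event.tick]) l C _ hp
      set j := σ.commit (s.hist ++ [Event.tick]) l C (pending n Δ s.base s.time l C)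
      have hj' := (mem_pending hΔ).1 hj
      have hne := hs j hj'.1
      have hv := σ.store_mem (s.hist ++ [Event.tick]) l C j _ hne
      simp only [hne, dite_true]
      set v := σ.store (s.hist ++ [Event.tick]) l C j (storeCandidates n Δ s l j)
      obtain ⟨hv1, hv2⟩ := Finset.mem_inter.1 hv
      obtain ⟨h1, h2, h3, J, h4, h5⟩ :=
        ih _ (pending_card_lt _ _ _ _ _ _ _ _ hj hv2) (insert v C) rfl
      have hvm := h1 (Finset.mem_insert_self v C)
      refine ⟨(Finset.subset_insert v C).trans h1, ?_, h3, insert j J, ?_, ?_⟩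
      · intro w hw
        have := h2 hw
        simp only [Finset.mem_union, Finset.mem_insert] at this ⊢
        rcases this with (rfl | h) | h
        · right; exact hv1
        · exact .inl h
        · exact .inr h
      -- The node just stored lies in the neighborhood of `j`, so `j` cannot commit again.
      · have hjJ : j ∉ J := fun h =>
          Finset.disjoint_left.1 (h5 j h).2.1 (Finset.mem_insert_self v C) hv2
        have := Finset.card_insert_le v C
        rw [Finset.card_insert_of_notMem hjJ]
        omega
      · intro i hi
        rcases Finset.mem_insert.1 hi with rfl | hi
        · exact ⟨hj'.1, hj'.2, v, hvm, hv2⟩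
        · obtain ⟨h6, h7, h8⟩ := h5 i hi
          exact ⟨h6, h7.mono_left (Finset.subset_insert v C), h8⟩
    · refine ⟨subset_rfl, Finset.subset_union_left, fun j hj => ?_, ∅, by simp, by simp⟩
      by_contra hcon
      push Not at hcon
      exact hp ⟨j, (mem_pending hΔ).2 ⟨hj, Finset.disjoint_left.2 hcon⟩⟩

/-- The properties of the set of commitments of one storage phase: it consists of pairs
(level, index) of stay-active intervals without the origin in their neighborhood, and
the neighborhood of each one lacks a node in the neighborhood of each one of lower level. -/
structure IsCommitSet (n Δ root : ℕ) (base : Finset Replica) (t : ℕ) (K : Finset (ℕ × ℕ)) :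
    Prop where
  level : ∀ a ∈ K, a.1 ≤ topLevel n Δ
  active : ∀ a ∈ K, StayActive n Δ base t a.1 a.2
  root_notMem : ∀ a ∈ K, root ∉ neighborhood n Δ a.1 a.2
  not_subset : ∀ a ∈ K, ∀ b ∈ K, b.1 < a.1 →
    ¬ neighborhood n Δ b.1 b.2 ⊆ neighborhood n Δ a.1 a.2

/-- The origin is stored first, so no committing neighborhood contains it. A commitment of lower
level has a stored node in its neighborhood when a higher level starts, and the higher neighborhoods
that commit avoid this node; this gives `not_subset`. -/
theorem nextCache_spec (n Δ root : ℕ) (hΔ : 0 < Δ) (σ : TieBreaking) (s : State)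
    (hs : s.Supplied n Δ) :
    root ∈ nextCache n Δ root σ s ∧
    nextCache n Δ root σ s ⊆ insert root s.available ∧
    (∀ l ≤ topLevel n Δ, ∀ j, StayActive n Δ s.base s.time l j →
      ∃ v ∈ nextCache n Δ root σ s, v ∈ neighborhood n Δ l j) ∧
    ∃ K, IsCommitSet n Δ root s.base s.time K ∧ (nextCache n Δ root σ s).card ≤ 1 + K.card := by
  have key : ∀ m ≤ topLevel n Δ + 1, ∀ C,
      (List.range m).foldl (fun C l => storeLevel n Δ σ s l C) {root} = C →
      root ∈ C ∧ C ⊆ insert root s.available ∧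
      (∀ l < m, ∀ j, StayActive n Δ s.base s.time l j → ∃ v ∈ C, v ∈ neighborhood n Δ l j) ∧
      ∃ K, IsCommitSet n Δ root s.base s.time K ∧ C.card ≤ 1 + K.card ∧
        ∀ a ∈ K, a.1 < m ∧ ∃ v ∈ C, v ∈ neighborhood n Δ a.1 a.2 := by
    intro m
    induction m with
    | zero =>
      rintro - C rfl
      exact ⟨by simp, by simp, by simp, ∅, ⟨by simp, by simp, by simp, by simp⟩, by simp, by simp⟩
    | succ m ih =>
      rintro hm C rfl
      obtain ⟨h1, h2, h3, K, hK, h4, h5⟩ := ih (by omega) _ rfl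
      rw [List.range_succ, List.foldl_append, List.foldl_cons, List.foldl_nil]
      set C := (List.range m).foldl (fun C l => storeLevel n Δ σ s l C) {root}
      obtain ⟨g1, g2, g3, J, g4, g5⟩ :=
        storeLevel_spec n Δ hΔ σ s m (hs m (by omega)) C
      refine ⟨g1 h1, ?_, ?_, K ∪ J.image (fun j => (m, j)), ?_, ?_, ?_⟩
      · exact g2.trans (Finset.union_subset h2 (Finset.subset_insert _ _))
      · intro l hl j hj
        by_cases hlm : l < m
        · obtain ⟨v, hv, hv'⟩ := h3 l hlm j hj
          exact ⟨v, g1 hv, hv'⟩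
        · obtain rfl : l = m := by omega
          exact g3 j hj
      · constructor
        · intro a ha
          simp only [Finset.mem_union, Finset.mem_image] at ha
          rcases ha with ha | ⟨j, hj, rfl⟩
          · exact hK.level a ha
          · simp only; omega
        · intro a ha
          simp only [Finset.mem_union, Finset.mem_image] at ha
          rcases ha with ha | ⟨j, hj, rfl⟩
          · exact hK.active a ha
          · exact (g5 j hj).1
        · intro a ha
          simp only [Finset.mem_union, Finset.mem_image] at ha
          rcases ha with ha | ⟨j, hj, rfl⟩
          · exact hK.root_notMem a ha
          · exact Finset.disjoint_left.1 (g5 j hj).2.1 h1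
        · intro a ha b hb hlt
          simp only [Finset.mem_union, Finset.mem_image] at ha hb
          rcases ha with ha | ⟨j, hj, rfl⟩
          · rcases hb with hb | ⟨j', hj', rfl⟩
            · exact hK.not_subset a ha b hb hlt
            · have := (h5 a ha).1
              simp only at hlt
              omega
          · rcases hb with hb | ⟨j', hj', rfl⟩
            · obtain ⟨-, v, hv, hv'⟩ := h5 b hb
              exact fun hsub => Finset.disjoint_left.1 (g5 j hj).2.1 hv (hsub hv')
            · simp at hlt
      · rw [Finset.card_union_of_disjoint, Finset.card_image_of_injective]
        · omega
        · intro a b hab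
          simpa using hab
        · rw [Finset.disjoint_left]
          intro a ha ha'
          simp only [Finset.mem_image] at ha'
          obtain ⟨j, -, rfl⟩ := ha'
          have := (h5 _ ha).1
          simp at this
      · intro a ha
        simp only [Finset.mem_union, Finset.mem_image] at ha
        rcases ha with ha | ⟨j, hj, rfl⟩
        · obtain ⟨h6, v, hv, hv'⟩ := h5 a ha
          exact ⟨by omega, v, g1 hv, hv'⟩
        · exact ⟨by simp, (g5 j hj).2.2⟩
  obtain ⟨h1, h2, h3, K, hK, h4, -⟩ := key _ le_rfl _ rfl
  exact ⟨h1, h2, fun l hl => h3 l (by omega), K, hK, h4⟩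

/-! ### Invariants of the algorithm -/

/-- The invariant of the states of `LineOn`. -/
structure State.Inv (n Δ root : ℕ) (s : State) : Prop where
  root_cache : root ∈ s.cache
  cache_subset : s.cache ⊆ s.copies
  copies_node : ∀ v ∈ s.copies, IsNode n v
  copies_reach : ∀ v ∈ s.copies, Reach s.sol (root, 0) (v, s.time)
  base_node : ∀ p ∈ s.base, IsNode n p.1
  base_time : ∀ p ∈ s.base, p.2 ≤ s.time
  base_copies : ∀ p ∈ s.base, p.2 = s.time → p.1 ∈ s.copies
  base_offline : s.base ⊆ s.offline
  origin_offline : (root, 0) ∈ s.offline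
  offline_time : ∀ p ∈ s.offline, p.2 ≤ s.time
  -- Triangle's vertical paths need no storage of their own: each ends in a base replica, which
  -- keeps intervals around its column stay-active.
  offline_base : ∀ p ∈ s.offline, p = (root, 0) ∨ ∃ t, p.2 ≤ t ∧ (p.1, t) ∈ s.base
  -- The cache was chosen at the end of the previous time, so the condition is stay-activity one
  -- time step earlier: hence `<` here and `≤` in the next bound.
  stored : ∀ l ≤ topLevel n Δ, ∀ j, ∀ p ∈ s.base, p.1 ∈ interval n Δ l j → p.2 < s.time →
    s.time ≤ p.2 + 2 ^ l → ∃ v ∈ s.cache, v ∈ neighborhood n Δ l j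

theorem State.Inv.available_subset {n Δ root : ℕ} {s : State} (hs : s.Inv n Δ root) :
    s.available ⊆ s.copies := by
  refine Finset.union_subset hs.cache_subset fun v hv => ?_
  obtain ⟨p, hp, rfl⟩ := Finset.mem_image.1 hv
  obtain ⟨hp, ht⟩ := Finset.mem_filter.1 hp
  exact hs.base_copies p hp ht

/-- A base replica of the current time is itself a candidate. An earlier one made the interval
stay-active at the previous time too, so the cache already meets the neighborhood. -/
theorem State.Inv.supplied {n Δ root : ℕ} {s : State} (hs : s.Inv n Δ root) :
    s.Supplied n Δ := by
  rintro l hl j ⟨p, hp, hpI, hp1, hp2⟩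
  rcases hp1.lt_or_eq with hlt | heq
  · obtain ⟨v, hv, hv'⟩ := hs.stored l hl j p hp hpI hlt hp2.le
    exact ⟨v, Finset.mem_inter.2 ⟨Finset.mem_union_left _ hv, hv'⟩⟩
  · exact ⟨p.1, Finset.mem_inter.2 ⟨Finset.mem_union_right _
      (Finset.mem_image_of_mem _ (Finset.mem_filter.2 ⟨hp, heq⟩)),
      interval_subset_neighborhood _ _ _ _ hpI⟩⟩

theorem initial_inv (n Δ root : ℕ) (hr : IsNode n root) : (initial root).Inv n Δ root where
  root_cache := by simp [initial]
  cache_subset := by simp [initial]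
  copies_node := by simpa [initial] using hr
  copies_reach := by
    simp only [initial, Finset.mem_singleton, forall_eq]
    exact .refl
  base_node := by simp [initial]
  base_time := by simp [initial]
  base_copies := by simp [initial]
  base_offline := by simp [initial]
  origin_offline := by simp [initial]
  offline_time := by simp [initial]
  offline_base := by simp [initial]
  stored := by simp [initial]

theorem store_inv {n Δ root : ℕ} (hΔ : 0 < Δ) (σ : TieBreaking) {s : State}
    (hs : s.Inv n Δ root) : (store n Δ root σ s).Inv n Δ root := by
  obtain ⟨h1, h2, h3, -⟩ := nextCache_spec n Δ root hΔ σ s hs.supplied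
  have hC : nextCache n Δ root σ s ⊆ s.copies :=
    h2.trans (Finset.insert_subset (hs.cache_subset hs.root_cache) hs.available_subset)
  constructor
  · exact h1
  · exact subset_rfl
  · exact fun v hv => hs.copies_node v (hC hv)
  · intro v hv
    refine ((hs.copies_reach v (hC hv)).mono Finset.subset_union_left).tail (.up v s.time ?_)
    exact Finset.mem_union_right _ (Finset.mem_image_of_mem _ hv)
  · exact hs.base_node
  · exact fun p hp => Nat.le_succ_of_le (hs.base_time p hp)
  · intro p hp ht
    have := hs.base_time p hp
    simp only [store] at ht
    omega
  · exact hs.base_offline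
  · exact hs.origin_offline
  · exact fun p hp => Nat.le_succ_of_le (hs.offline_time p hp)
  · exact hs.offline_base
  · intro l hl j p hp hpI hlt hle
    simp only [store] at hlt hle
    exact h3 l hl j ⟨p, hp, hpI, by omega, by omega⟩

/-! ### The delivery phase -/

/-- The edges added in the delivery phase. -/
def deliveryEdges (n v u ρ t : ℕ) : Finset Edge := pathEdges u v t ∪ baseEdges n v ρ t

theorem mem_pathEdges {a b t : ℕ} {e : Edge} :
    e ∈ pathEdges a b t ↔ ∃ w, (min a b ≤ w ∧ w < max a b) ∧ Edge.hor w t = e := by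
  simp [pathEdges]

theorem mem_baseNodes {n v ρ w : ℕ} : w ∈ baseNodes n v ρ ↔ IsNode n w ∧ Nat.dist w v ≤ ρ := by
  simp [baseNodes, IsNode]

theorem mem_baseEdges {n v ρ t : ℕ} {e : Edge} : e ∈ baseEdges n v ρ t ↔
    ∃ w, (w ∈ baseNodes n v ρ ∧ w + 1 ∈ baseNodes n v ρ) ∧ Edge.hor w t = e := by
  simp [baseEdges]

theorem card_pathEdges_le (a b t : ℕ) : (pathEdges a b t).card ≤ Nat.dist a b := by
  refine Finset.card_image_le.trans ?_
  simp only [Nat.card_Ico, Nat.dist]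
  omega

theorem card_baseEdges_le (n v ρ t : ℕ) : (baseEdges n v ρ t).card ≤ 2 * ρ := by
  refine Finset.card_image_le.trans ?_
  have : (baseNodes n v ρ).filter (fun w => w + 1 ∈ baseNodes n v ρ) ⊆
      Finset.Ico (v - ρ) (v + ρ) := by
    intro w hw
    simp only [Finset.mem_filter, mem_baseNodes, Nat.dist, Finset.mem_Ico] at hw ⊢
    omega
  refine (Finset.card_le_card this).trans ?_
  simp only [Nat.card_Ico]
  omega

theorem reach_delivery {n v u ρ t w : ℕ} {F : Finset Edge} {o : Replica} (hv : IsNode n v)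
    (hF : deliveryEdges n v u ρ t ⊆ F) (hu : Reach F o (u, t))
    (hw : (min u v ≤ w ∧ w ≤ max u v) ∨ w ∈ baseNodes n v ρ) : Reach F o (w, t) := by
  rcases hw with hw | hw
  · refine hu.trans (reach_row fun x h1 h2 => hF ?_)
    exact Finset.mem_union_left _ (mem_pathEdges.2 ⟨x, ⟨by omega, by omega⟩, rfl⟩)
  · have huv : Reach F o (v, t) := by
      refine hu.trans (reach_row fun x h1 h2 => hF ?_)
      exact Finset.mem_union_left _ (mem_pathEdges.2 ⟨x, ⟨by omega, by omega⟩, rfl⟩)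
    refine huv.trans (reach_row fun x h1 h2 => hF ?_)
    refine Finset.mem_union_right _ (mem_baseEdges.2 ⟨x, ?_, rfl⟩)
    simp only [mem_baseNodes, Nat.dist, IsNode] at hw hv ⊢
    omega

/-- The nodes of the edges added in the delivery phase lie on the path or in the base. -/
theorem of_mem_nodes_deliveryEdges {n v u ρ t w : ℕ}
    (h : w ∈ (deliveryEdges n v u ρ t).biUnion Edge.nodes) :
    (min u v ≤ w ∧ w ≤ max u v) ∨ w ∈ baseNodes n v ρ := by
  simp only [Finset.mem_biUnion, deliveryEdges, Finset.mem_union, mem_pathEdges,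
    mem_baseEdges] at h
  obtain ⟨e, ⟨x, hx, rfl⟩ | ⟨x, hx, rfl⟩, hw⟩ := h
  · simp only [Edge.nodes, Finset.mem_insert, Finset.mem_singleton] at hw
    left; omega
  · simp only [Edge.nodes, Finset.mem_insert, Finset.mem_singleton] at hw
    right
    rcases hw with rfl | rfl
    · exact hx.1
    · exact hx.2

/-- All nodes of the base hold a copy after the delivery. -/
theorem mem_copies_of_mem_baseNodes {n v u ρ t w : ℕ} (hv : IsNode n v) {S : Finset ℕ}
    (hu : u ∈ S) (hw : w ∈ baseNodes n v ρ) :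
    w ∈ S ∪ (deliveryEdges n v u ρ t).biUnion Edge.nodes := by
  by_cases hwv : w = v
  · subst hwv
    by_cases huw : u = w
    · subst huw
      exact Finset.mem_union_left _ hu
    · refine Finset.mem_union_right _ (Finset.mem_biUnion.2 ?_)
      rcases Nat.lt_or_gt_of_ne huw with h | h
      · refine ⟨.hor (w - 1) t, Finset.mem_union_left _ (mem_pathEdges.2 ⟨_, by omega, rfl⟩), ?_⟩
        simp only [Edge.nodes, Finset.mem_insert, Finset.mem_singleton]
        omega
      · refine ⟨.hor w t, Finset.mem_union_left _ (mem_pathEdges.2 ⟨_, by omega, rfl⟩), ?_⟩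
        simp [Edge.nodes]
  · refine Finset.mem_union_right _ (Finset.mem_biUnion.2 ?_)
    simp only [mem_baseNodes, Nat.dist, IsNode] at hw hv
    rcases Nat.lt_or_gt_of_ne hwv with h | h
    · refine ⟨.hor w t, Finset.mem_union_right _ (mem_baseEdges.2 ⟨_, ?_, rfl⟩), ?_⟩
      · simp only [mem_baseNodes, Nat.dist, IsNode]
        omega
      · simp [Edge.nodes]
    · refine ⟨.hor (w - 1) t, Finset.mem_union_right _ (mem_baseEdges.2 ⟨_, ?_, rfl⟩), ?_⟩
      · simp only [mem_baseNodes, Nat.dist, IsNode]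
        omega
      · simp only [Edge.nodes, Finset.mem_insert, Finset.mem_singleton]
        omega

/-- The delivery with serving replica `q` of the offline solution and serving node `u`. -/
def deliverFrom (n : ℕ) (s : State) (v : ℕ) (q : Replica) (u : ℕ) : State where
  hist := s.hist ++ [Event.request v]
  time := s.time
  offline := s.offline ∪ (Finset.Icc q.2 s.time).image (fun z => (q.1, z)) ∪
    (baseNodes n v (dist q (v, s.time))).image fun w => (w, s.time)
  base := s.base ∪ (baseNodes n v (dist q (v, s.time))).image fun w => (w, s.time)
  cache := s.cache
  copies := s.copies ∪ (deliveryEdges n v u (dist q (v, s.time)) s.time).biUnion Edge.nodes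
  sol := s.sol ∪ deliveryEdges n v u (dist q (v, s.time)) s.time

theorem exists_deliver_eq {n Δ root : ℕ} (σ : TieBreaking) {s : State} (hs : s.Inv n Δ root)
    (v : ℕ) : ∃ q u, deliver n σ s v = deliverFrom n s v q u ∧
      q ∈ s.offline ∧ (∀ p ∈ s.offline, dist q (v, s.time) ≤ dist p (v, s.time)) ∧
      u ∈ s.copies ∧ ∀ w ∈ s.copies, Nat.dist u v ≤ Nat.dist w v := by
  have h1 : (closest s.offline (v, s.time)).Nonempty := by
    obtain ⟨p, hp, hmin⟩ := Finset.exists_min_image s.offline (fun p => dist p (v, s.time))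
      ⟨_, hs.origin_offline⟩
    exact ⟨p, Finset.mem_filter.2 ⟨hp, hs.offline_time p hp, fun p' hp' _ => hmin p' hp'⟩⟩
  have h2 : (closestNodes s.copies v).Nonempty := by
    obtain ⟨p, hp, hmin⟩ := Finset.exists_min_image s.copies (fun p => Nat.dist p v)
      ⟨_, hs.cache_subset hs.root_cache⟩
    exact ⟨p, Finset.mem_filter.2 ⟨hp, hmin⟩⟩
  have h3 := σ.offline_mem (s.hist ++ [Event.request v]) _ h1
  have h4 := σ.serve_mem (s.hist ++ [Event.request v]) _ h2
  obtain ⟨h5, h6, h7⟩ := Finset.mem_filter.1 h3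
  obtain ⟨h8, h9⟩ := Finset.mem_filter.1 h4
  exact ⟨_, _, rfl, h5, fun p hp => h7 p hp (hs.offline_time p hp), h8, h9⟩

theorem deliverFrom_inv {n Δ root : ℕ} {s : State} (hs : s.Inv n Δ root) {v u : ℕ} {q : Replica}
    (hv : IsNode n v) (hq : q ∈ s.offline) (hu : u ∈ s.copies) :
    (deliverFrom n s v q u).Inv n Δ root := by
  have hqt := hs.offline_time q hq
  have hun := hs.copies_node u hu
  have hbase : ∀ p ∈ (deliverFrom n s v q u).base, p ∈ s.base ∨
      (p.2 = s.time ∧ p.1 ∈ baseNodes n v (dist q (v, s.time))) := by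
    intro p hp
    rcases Finset.mem_union.1 hp with hp | hp
    · exact .inl hp
    · obtain ⟨w, hw, rfl⟩ := Finset.mem_image.1 hp
      exact .inr ⟨rfl, hw⟩
  constructor
  · exact hs.root_cache
  · exact hs.cache_subset.trans Finset.subset_union_left
  · intro w hw
    rcases Finset.mem_union.1 hw with hw | hw
    · exact hs.copies_node w hw
    · rcases of_mem_nodes_deliveryEdges hw with hw | hw
      · simp only [IsNode] at *
        omega
      · exact (mem_baseNodes.1 hw).1
  · intro w hw
    rcases Finset.mem_union.1 hw with hw | hw
    · exact (hs.copies_reach w hw).mono Finset.subset_union_left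
    · exact reach_delivery hv Finset.subset_union_right
        ((hs.copies_reach u hu).mono Finset.subset_union_left) (of_mem_nodes_deliveryEdges hw)
  · intro p hp
    rcases hbase p hp with hp | hp
    · exact hs.base_node p hp
    · exact (mem_baseNodes.1 hp.2).1
  · intro p hp
    rcases hbase p hp with hp | hp
    · exact hs.base_time p hp
    · exact hp.1.le
  · intro p hp ht
    rcases hbase p hp with hp | hp
    · exact Finset.mem_union_left _ (hs.base_copies p hp ht)
    · exact mem_copies_of_mem_baseNodes hv hu hp.2
  · exact Finset.union_subset_union (hs.base_offline.trans Finset.subset_union_left) subset_rfl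
  · exact Finset.mem_union_left _ (Finset.mem_union_left _ hs.origin_offline)
  · intro p hp
    simp only [deliverFrom, Finset.mem_union, Finset.mem_image, Finset.mem_Icc] at hp
    rcases hp with (hp | ⟨z, hz, rfl⟩) | ⟨w, hw, rfl⟩
    · exact hs.offline_time p hp
    · exact hz.2
    · exact le_rfl
  · intro p hp
    simp only [deliverFrom, Finset.mem_union, Finset.mem_image, Finset.mem_Icc] at hp ⊢
    rcases hp with (hp | ⟨z, hz, rfl⟩) | ⟨w, hw, rfl⟩
    · rcases hs.offline_base p hp with h | ⟨t, ht, h⟩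
      · exact .inl h
      · exact .inr ⟨t, ht, .inl h⟩
    · right
      refine ⟨s.time, hz.2, ?_⟩
      -- The column of `q` meets the new base at the current time, as `q.1` is within the radius of
      -- `v`. The cases only serve to see that `q.1` is a node.
      rcases hs.offline_base q hq with h | ⟨t, ht, h⟩
      all_goals
        refine Or.inr ⟨q.1, mem_baseNodes.2 ⟨?_, ?_⟩, rfl⟩
      · rw [h]
        exact hs.copies_node root (hs.cache_subset hs.root_cache)
      · simp only [dist]; omega
      · exact hs.base_node (q.1, t) h
      · simp only [dist]; omega
    · exact .inr ⟨s.time, le_rfl, .inr ⟨w, hw, rfl⟩⟩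
  · intro l hl j p hp hpI hlt hle
    rcases hbase p hp with hp | hp
    · exact hs.stored l hl j p hp hpI hlt hle
    · have : p.2 < s.time := hlt
      omega

/-- Some copy is close to the requested node, compared with the radius of the offline solution. -/
theorem exists_copy_dist_le {n Δ root : ℕ} (hΔ : 0 < Δ) {s : State} (hs : s.Inv n Δ root) {v : ℕ}
    (hv : IsNode n v) {q : Replica} (hq : q ∈ s.offline) :
    ∃ w ∈ s.copies, Nat.dist w v ≤ (4 * Δ + 1) * dist q (v, s.time) := by
  set ρ := dist q (v, s.time) with hρ
  have hρ1 : Nat.dist q.1 v ≤ ρ := by simp only [hρ, dist]; omega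
  have hρ2 : s.time - q.2 ≤ ρ := by simp only [hρ, dist]; omega
  have hle : ρ ≤ (4 * Δ + 1) * ρ := Nat.le_mul_of_pos_left ρ (by omega)
  have hroot := hs.cache_subset hs.root_cache
  rcases hs.offline_base q hq with h | ⟨t, ht, h⟩
  · refine ⟨root, hroot, ?_⟩
    rw [h] at hρ1
    exact hρ1.trans hle
  · have htt : t ≤ s.time := hs.base_time _ h
    rcases htt.lt_or_eq with hlt | heq
    · have hρ0 : ρ ≠ 0 := by omega
      -- The level is the least one whose window 2^l covers the age of the base replica, which is at
      -- most ρ. As 2^l ≤ 2ρ, a copy in the neighborhood is within 2Δ2^l ≤ 4Δρ of `q.1`.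
      have h1 : ρ ≤ 2 ^ Nat.clog 2 ρ := Nat.le_pow_clog (by norm_num) _
      have h2 : 2 ^ Nat.clog 2 ρ ≤ 2 * ρ := by
        by_cases h : ρ = 1
        · simp [h]
        · have h3 := Nat.pow_pred_clog_lt_self (b := 2) (by norm_num) (x := ρ) (by omega)
          have h4 : 0 < Nat.clog 2 ρ := Nat.clog_pos (by norm_num) (by omega)
          obtain ⟨k, hk⟩ := Nat.exists_eq_add_of_le' h4
          rw [hk] at h3 ⊢
          simp only [Nat.succ_eq_add_one, zero_add, Nat.pred_eq_sub_one,
            Nat.add_sub_cancel] at h3 ⊢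
          rw [pow_succ]
          omega
      set l := Nat.clog 2 ρ
      have h5 : Δ * 2 ^ l ≤ 2 * (Δ * ρ) := by
        calc Δ * 2 ^ l ≤ Δ * (2 * ρ) := Nat.mul_le_mul_left _ h2
          _ = _ := by ring
      have h6 : (4 * Δ + 1) * ρ = 4 * (Δ * ρ) + ρ := by ring
      by_cases hl : l ≤ topLevel n Δ
      · obtain ⟨j, hj⟩ := exists_mem_interval l hΔ (hs.base_node _ h)
        obtain ⟨c, hc, hcN⟩ := hs.stored l hl j _ h hj hlt (by simp only; omega)
        refine ⟨c, hs.cache_subset hc, ?_⟩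
        have h7 := dist_lt_of_mem_neighborhood hΔ hj hcN
        have := Nat.dist.triangle_inequality c q.1 v
        simp only at h7
        omega
      -- Above the top level, n ≤ Δ2^l ≤ 2Δρ, so the origin will do.
      · refine ⟨root, hroot, ?_⟩
        have h7 := le_topLevel n Δ hΔ
        have h8 : Δ * 2 ^ topLevel n Δ ≤ Δ * 2 ^ l :=
          Nat.mul_le_mul_left _ (Nat.pow_le_pow_right (by norm_num) (by omega))
        have h9 := hs.copies_node root hroot
        simp only [Nat.dist, IsNode] at *
        omega
    · refine ⟨q.1, ?_, hρ1.trans hle⟩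
      exact hs.base_copies (q.1, t) h heq

/-- The path from the closest copy costs at most (4Δ + 1)ρ, and the base 2ρ. -/
theorem card_deliveryEdges_le {n Δ root : ℕ} (hΔ : 0 < Δ) {s : State} (hs : s.Inv n Δ root)
    {v u : ℕ} (hv : IsNode n v) {q : Replica} (hq : q ∈ s.offline)
    (hmin : ∀ w ∈ s.copies, Nat.dist u v ≤ Nat.dist w v) :
    (deliveryEdges n v u (dist q (v, s.time)) s.time).card ≤
      (4 * Δ + 3) * dist q (v, s.time) := by
  obtain ⟨w, hw, hd⟩ := exists_copy_dist_le hΔ hs hv hq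
  have h1 := hmin w hw
  have h2 := card_pathEdges_le u v s.time
  have h3 := card_baseEdges_le n v (dist q (v, s.time)) s.time
  have h4 := Finset.card_union_le (pathEdges u v s.time)
    (baseEdges n v (dist q (v, s.time)) s.time)
  have h5 : (4 * Δ + 3) * dist q (v, s.time) =
    (4 * Δ + 1) * dist q (v, s.time) + 2 * dist q (v, s.time) := by ring
  rw [deliveryEdges]
  omega

/-! ### Runs of the algorithm -/

/-- The state of `LineOn` after a history. -/
def run (n Δ root : ℕ) (σ : TieBreaking) (h : List Event) : State :=
  h.foldl (step n Δ root σ) (initial root)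

theorem run_request (n Δ root : ℕ) (σ : TieBreaking) (h : List Event) (v : ℕ) :
    run n Δ root σ (h ++ [.request v]) = deliver n σ (run n Δ root σ h) v := by
  simp [run, step]

theorem run_tick (n Δ root : ℕ) (σ : TieBreaking) (h : List Event) :
    run n Δ root σ (h ++ [.tick]) = store n Δ root σ (run n Δ root σ h) := by
  simp [run, step]

theorem ValidHistory.left {n : ℕ} {h : List Event} {e : Event} (hv : ValidHistory n (h ++ [e])) :
    ValidHistory n h :=
  fun v hm => hv v (List.mem_append_left _ hm)

theorem ValidHistory.isNode {n : ℕ} {h : List Event} {v : ℕ}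
    (hv : ValidHistory n (h ++ [.request v])) : IsNode n v :=
  hv v (List.mem_append_right _ List.mem_cons_self)

theorem run_time (n Δ root : ℕ) (σ : TieBreaking) (h : List Event) :
    (run n Δ root σ h).time = currentTime h := by
  induction h using List.reverseRecOn with
  | nil => rfl
  | append_singleton h e ih =>
    cases e with
    | request v =>
      rw [run_request, currentTime, List.count_append]
      simpa [deliver, currentTime] using ih
    | tick =>
      rw [run_tick, currentTime, List.count_append]
      simpa [store, currentTime] using ih

theorem run_inv {n Δ root : ℕ} (hΔ : 0 < Δ) (hr : IsNode n root) (σ : TieBreaking)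
    {h : List Event} (hv : ValidHistory n h) : (run n Δ root σ h).Inv n Δ root := by
  induction h using List.reverseRecOn with
  | nil => exact initial_inv n Δ root hr
  | append_singleton h e ih =>
    have ih := ih hv.left
    cases e with
    | request v =>
      obtain ⟨q, u, heq, hq, -, hu, -⟩ := exists_deliver_eq σ ih v
      rw [run_request, heq]
      exact deliverFrom_inv ih hv.isNode hq hu
    | tick =>
      rw [run_tick]
      exact store_inv hΔ σ ih

theorem isOnlineAlgorithm_lineOn {n Δ root : ℕ} (hΔ : 0 < Δ) (hr : IsNode n root)
    (σ : TieBreaking) : IsOnlineAlgorithm n root (lineOn n Δ root σ) := by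
  have hrun : ∀ h, lineOn n Δ root σ h = (run n Δ root σ h).sol := fun _ => rfl
  constructor
  · rfl
  · intro h e hv
    rw [hrun, hrun]
    cases e with
    | request v =>
      rw [run_request]
      exact Finset.subset_union_left
    | tick =>
      rw [run_tick]
      exact Finset.subset_union_left
  · intro h v hv
    rw [hrun, hrun, run_request, ← run_time n Δ root σ h]
    have hs := run_inv hΔ hr σ hv.left
    have hvn := hv.isNode
    set s := run n Δ root σ h
    obtain ⟨q, u, heq, hq, -, hu, -⟩ := exists_deliver_eq σ hs v
    rw [heq]
    have hreach := (hs.copies_reach u hu).mono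
      (F := s.sol) (G := (deliverFrom n s v q u).sol) Finset.subset_union_left
    have hun := hs.copies_node u hu
    refine ⟨reach_delivery hvn Finset.subset_union_right hreach (.inl (by omega)), ?_⟩
    intro e he
    obtain ⟨he, hnot⟩ := Finset.mem_sdiff.1 he
    rcases Finset.mem_union.1 he with he | he
    · exact absurd he hnot
    rcases Finset.mem_union.1 he with he | he
    · obtain ⟨w, hw, rfl⟩ := mem_pathEdges.1 he
      refine ⟨w, rfl, ?_, reach_delivery hvn Finset.subset_union_right hreach (.inl (by omega))⟩
      simp only [IsEdge, IsNode] at *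
      omega
    · obtain ⟨w, hw, rfl⟩ := mem_baseEdges.1 he
      exact ⟨w, rfl, ⟨(mem_baseNodes.1 hw.1).1, (mem_baseNodes.1 hw.2).1⟩,
        reach_delivery hvn Finset.subset_union_right hreach (.inr hw.1)⟩
  · intro h hv e he
    rw [hrun, hrun, run_tick] at he
    rw [hrun, ← run_time n Δ root σ h]
    have hs := run_inv hΔ hr σ hv
    set s := run n Δ root σ h
    obtain ⟨he, hnot⟩ := Finset.mem_sdiff.1 he
    rcases Finset.mem_union.1 he with he | he
    · exact absurd he hnot
    obtain ⟨w, hw, rfl⟩ := Finset.mem_image.1 he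
    have hwC : w ∈ s.copies :=
      (nextCache_spec n Δ root hΔ σ s hs.supplied).2.1.trans
        (Finset.insert_subset (hs.cache_subset hs.root_cache) hs.available_subset) hw
    exact ⟨w, rfl, hs.copies_node w hwC, hs.copies_reach w hwC⟩

/-! ### Timed requests of a history -/

/-- The requests of a history that starts at time `t`, with their times. -/
def timed : ℕ → List Event → List Replica
  | _, [] => []
  | t, .request v :: h => (v, t) :: timed t h
  | t, .tick :: h => timed (t + 1) h

theorem timed_append (t : ℕ) (h h' : List Event) :
    timed t (h ++ h') = timed t h ++ timed (t + currentTime h) h' := by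
  induction h generalizing t with
  | nil => simp [timed, currentTime]
  | cons e h ih =>
    cases e with
    | request v => simp [timed, ih, currentTime]
    | tick =>
      simp only [List.cons_append, timed, ih, currentTime, List.count_cons_self]
      congr 2
      ring

theorem timed_map_request (t : ℕ) (l : List Replica) (hl : ∀ r ∈ l, r.2 = t) (h : List Event) :
    timed t ((l.map fun r => Event.request r.1) ++ h) = l ++ timed t h := by
  induction l with
  | nil => rfl
  | cons r l ih =>
    simp only [List.map_cons, List.cons_append, timed]
    rw [ih fun r hr => hl r (List.mem_cons_of_mem _ hr), ← hl r List.mem_cons_self]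

/-- The events of the times before `m`. -/
def eventsBefore (R : List Replica) (m : ℕ) : List Event :=
  (List.range m).flatMap fun t =>
    ((R.filter fun r => r.2 = t).map fun r => Event.request r.1) ++ [Event.tick]

theorem eventsBefore_succ (R : List Replica) (m : ℕ) :
    eventsBefore R (m + 1) = eventsBefore R m ++
      (((R.filter fun r => r.2 = m).map fun r => Event.request r.1) ++ [Event.tick]) := by
  simp [eventsBefore, List.range_succ]

theorem currentTime_eventsBefore (R : List Replica) (m : ℕ) :
    currentTime (eventsBefore R m) = m := by
  induction m with
  | zero => rfl
  | succ m ih =>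
    rw [eventsBefore_succ]
    simp only [currentTime, List.count_append] at ih ⊢
    rw [ih, List.count_eq_zero_of_not_mem (by simp)]
    simp

theorem mem_timed_eventsBefore {R : List Replica} {m : ℕ} {r : Replica} :
    r ∈ timed 0 (eventsBefore R m) ↔ r ∈ R ∧ r.2 < m := by
  induction m with
  | zero => simp [eventsBefore, timed]
  | succ m ih =>
    rw [eventsBefore_succ, timed_append, currentTime_eventsBefore, zero_add,
      timed_map_request _ _ (by simp), List.mem_append, ih]
    simp only [timed, List.append_nil, List.mem_filter, decide_eq_true_eq]
    grind

theorem le_lastTime {R : List Replica} {r : Replica} (h : r ∈ R) : r.2 ≤ lastTime R := by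
  induction R with
  | nil => simp at h
  | cons a R ih =>
    rcases List.mem_cons.1 h with rfl | h
    · simp [lastTime]
    · have := ih h
      simp only [lastTime, List.map_cons, List.foldr_cons] at this ⊢
      omega

theorem lastTime_le {R : List Replica} {b : ℕ} (h : ∀ r ∈ R, r.2 ≤ b) : lastTime R ≤ b := by
  induction R with
  | nil => simp [lastTime]
  | cons a R ih =>
    have h1 := ih fun r hr => h r (List.mem_cons_of_mem _ hr)
    have h2 := h a List.mem_cons_self
    simp only [lastTime, List.map_cons, List.foldr_cons] at h1 ⊢
    omega

theorem mem_timed_events {R : List Replica} {r : Replica} :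
    r ∈ timed 0 (events R) ↔ r ∈ R := by
  refine (mem_timed_eventsBefore (m := lastTime R + 1)).trans ⟨fun h => h.1, fun h => ⟨h, ?_⟩⟩
  have := le_lastTime h
  omega

theorem validHistory_events {n : ℕ} {R : List Replica} (hR : ∀ r ∈ R, IsNode n r.1) :
    ValidHistory n (events R) := by
  intro v hv
  simp only [events, List.mem_flatMap, List.mem_append, List.mem_map, List.mem_filter,
    List.mem_singleton, reduceCtorEq, or_false, Event.request.injEq] at hv
  obtain ⟨t, -, r, ⟨hr, -⟩, rfl⟩ := hv
  exact hR r hr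

/-- Every request of the history is served. -/
theorem lineOn_reach {n Δ root : ℕ} (hΔ : 0 < Δ) (hr : IsNode n root) (σ : TieBreaking)
    {h : List Event} (hv : ValidHistory n h) :
    (∀ e ∈ lineOn n Δ root σ h, IsEdge n e) ∧
      ∀ r ∈ timed 0 h, Reach (lineOn n Δ root σ h) (root, 0) r := by
  have hA := isOnlineAlgorithm_lineOn hΔ hr σ
  induction h using List.reverseRecOn with
  | nil => simp [timed, hA.start]
  | append_singleton h e ih =>
    obtain ⟨ih1, ih2⟩ := ih hv.left
    have hm := hA.mono h e hv
    rw [timed_append, zero_add]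
    cases e with
    | request v =>
      obtain ⟨h1, h2⟩ := hA.request h v hv
      refine ⟨fun e he => ?_, fun r hr => ?_⟩
      · by_cases heh : e ∈ lineOn n Δ root σ h
        · exact ih1 e heh
        · obtain ⟨w, -, he, -⟩ := h2 e (Finset.mem_sdiff.2 ⟨he, heh⟩)
          exact he
      · rcases List.mem_append.1 hr with hr | hr
        · exact (ih2 r hr).mono hm
        · simp only [timed, List.mem_singleton] at hr
          rw [hr]
          exact h1
    | tick =>
      have h2 := hA.tick h hv.left
      refine ⟨fun e he => ?_, fun r hr => ?_⟩
      · by_cases heh : e ∈ lineOn n Δ root σ h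
        · exact ih1 e heh
        · obtain ⟨w, -, he, -⟩ := h2 e (Finset.mem_sdiff.2 ⟨he, heh⟩)
          exact he
      · simp only [timed, List.append_nil] at hr
        exact (ih2 r hr).mono hm

/-! ### Accounting -/

/-- The data of a run that bound its cost: the requests with their radii, and for each past time
the commitments of its storage phase. -/
structure IsTrace (n Δ root : ℕ) (h : List Event) (s : State) (T : List (Replica × ℕ))
    (K : ℕ → Finset (ℕ × ℕ)) : Prop where
  node : ∀ a ∈ T, IsNode n a.1.1
  requests : T.map Prod.fst = timed 0 h
  base : ∀ p ∈ s.base, ∃ a ∈ T, p.2 = a.1.2 ∧ p.1 ∈ baseNodes n a.1.1 a.2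
  base' : ∀ a ∈ T, ∀ x ∈ baseNodes n a.1.1 a.2, (x, a.1.2) ∈ s.base
  pairwise : T.Pairwise (Respects n)
  origin : ∀ a ∈ T, a.2 ≤ dist (root, 0) a.1
  commit : ∀ t < s.time, IsCommitSet n Δ root s.base t (K t)
  -- In each storage phase the summand 1 pays for the arc at the origin.
  cost : s.sol.card ≤ (4 * Δ + 3) * (T.map Prod.snd).sum +
    ∑ t ∈ Finset.range s.time, (1 + (K t).card)

/-- Lets past commitments be tested against the growing base: only `active` depends on it,
monotonically. -/
theorem IsCommitSet.mono {n Δ root : ℕ} {B B' : Finset Replica} (hB : B ⊆ B') {t : ℕ}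
    {K : Finset (ℕ × ℕ)} (h : IsCommitSet n Δ root B t K) : IsCommitSet n Δ root B' t K where
  level := h.level
  active a ha := by
    obtain ⟨p, hp, hp'⟩ := h.active a ha
    exact ⟨p, hB hp, hp'⟩
  root_notMem := h.root_notMem
  not_subset := h.not_subset

theorem exists_isTrace {n Δ root : ℕ} (hΔ : 0 < Δ) (hr : IsNode n root) (σ : TieBreaking)
    {h : List Event} (hv : ValidHistory n h) :
    ∃ T K, IsTrace n Δ root h (run n Δ root σ h) T K := by
  induction h using List.reverseRecOn with
  | nil => exact ⟨[], fun _ => ∅, by constructor <;> simp [run, initial, timed]⟩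
  | append_singleton h e ih =>
    obtain ⟨T, K, ih⟩ := ih hv.left
    have hs := run_inv hΔ hr σ hv.left
    have htime := run_time n Δ root σ h
    set s := run n Δ root σ h with hsdef
    cases e with
    | request v =>
      obtain ⟨q, u, heq, hq, hqmin, hu, humin⟩ := exists_deliver_eq σ hs v
      rw [run_request, heq]
      set ρ := dist q (v, s.time) with hρ
      refine ⟨T ++ [((v, s.time), ρ)], K, fun a ha => ?_, ?_, ?_, ?_, ?_, ?_, ?_, ?_⟩
      · rcases List.mem_append.1 ha with ha | ha
        · exact ih.node a ha
        · rw [List.mem_singleton] at ha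
          subst ha
          exact hv.isNode
      · rw [List.map_append, ih.requests, timed_append, zero_add, ← htime]
        rfl
      · intro p hp
        rcases Finset.mem_union.1 hp with hp | hp
        · obtain ⟨a, ha, h'⟩ := ih.base p hp
          exact ⟨a, List.mem_append_left _ ha, h'⟩
        · obtain ⟨w, hw, rfl⟩ := Finset.mem_image.1 hp
          exact ⟨_, List.mem_append_right _ List.mem_cons_self, rfl, hw⟩
      · intro a ha x hx
        rcases List.mem_append.1 ha with ha | ha
        · exact Finset.mem_union_left _ (ih.base' a ha x hx)
        · rw [List.mem_singleton] at ha
          subst ha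
          exact Finset.mem_union_right _ (Finset.mem_image_of_mem _ hx)
      · rw [List.pairwise_append]
        refine ⟨ih.pairwise, List.pairwise_singleton _ _, fun a ha b hb => ?_⟩
        rw [List.mem_singleton] at hb
        subst hb
        -- Earlier bases belong to Triangle's solution, so minimality of the new radius gives
        -- `Respects`. The order of times comes from the request replica, which lies in its own
        -- base.
        have key : ∀ x, IsNode n x → Nat.dist x a.1.1 ≤ a.2 → (x, a.1.2) ∈ s.base :=
          fun x hx hd => ih.base' a ha x (mem_baseNodes.2 ⟨hx, hd⟩)
        refine ⟨?_, fun x hx hd => hqmin _ (hs.base_offline (key x hx hd))⟩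
        exact hs.base_time _ (key a.1.1 (ih.node a ha) (by simp))
      · intro a ha
        rcases List.mem_append.1 ha with ha | ha
        · exact ih.origin a ha
        · rw [List.mem_singleton] at ha
          subst ha
          exact hqmin _ hs.origin_offline
      · exact fun t ht => (ih.commit t ht).mono Finset.subset_union_left
      · have h1 := card_deliveryEdges_le hΔ hs hv.isNode hq humin
        have h2 := Finset.card_union_le s.sol (deliveryEdges n v u ρ s.time)
        have h3 := ih.cost
        simp only [List.map_append, List.map_cons, List.map_nil, List.sum_append,
          List.sum_singleton, mul_add]
        rw [← hρ] at h1
        simp only [deliverFrom, ← hρ]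
        omega
    | tick =>
      obtain ⟨-, -, -, J, hJ, hJc⟩ := nextCache_spec n Δ root hΔ σ s hs.supplied
      rw [run_tick, ← hsdef]
      refine ⟨T, Function.update K s.time J, ih.node, ?_, ih.base, ih.base', ih.pairwise, ih.origin, ?_, ?_⟩
      · rw [ih.requests, timed_append]
        simp [timed]
      · intro t ht
        simp only [store] at ht
        by_cases htt : t = s.time
        · subst htt
          rw [Function.update_self]
          exact hJ
        · rw [Function.update_of_ne htt]
          exact ih.commit t (by omega)
      · have h2 := Finset.card_union_le s.sol
          ((nextCache n Δ root σ s).image fun v => Edge.arc v s.time)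
        have h4 : ((nextCache n Δ root σ s).image fun v => Edge.arc v s.time).card ≤ _ :=
          Finset.card_image_le
        have h3 := ih.cost
        have h5 : ∑ t ∈ Finset.range s.time, (1 + (Function.update K s.time J t).card) =
            ∑ t ∈ Finset.range s.time, (1 + (K t).card) :=
          Finset.sum_congr rfl fun t ht => by
            rw [Function.update_of_ne (Finset.mem_range.1 ht).ne]
        simp only [store]
        rw [Finset.sum_range_succ, h5, Function.update_self]
        omega

/-! ### Counting commitments -/

/-- A commitment: a time, a level, and the index of an interval. -/
abbrev Commit := Σ _ : ℕ, ℕ × ℕ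

/-- The length of the committing interval. -/
def Commit.len (Δ : ℕ) (p : Commit) : ℕ := Δ * 2 ^ p.2.1

/-- The base of radius `b.2` of the request `b.1` makes the interval of `p` stay-active. -/
def Witness (n Δ : ℕ) (b : Replica × ℕ) (p : Commit) : Prop :=
  (∃ w ∈ interval n Δ p.2.1 p.2.2, Nat.dist w b.1.1 ≤ b.2) ∧
    b.1.2 ≤ p.1 ∧ p.1 < b.1.2 + 2 ^ p.2.1

theorem Commit.ext {p q : Commit} (h1 : p.1 = q.1) (h2 : p.2.1 = q.2.1) (h3 : p.2.2 = q.2.2) :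
    p = q := by
  obtain ⟨a, b, c⟩ := p
  obtain ⟨a', b', c'⟩ := q
  simp only at h1 h2 h3
  subst h1 h2 h3
  rfl

/-- A set of commitments is bounded by the number of levels times a bound for each level. -/
theorem mul_card_le_of_levels {S : Finset Commit} {L Δ c : ℕ} (hL : ∀ p ∈ S, p.2.1 ≤ L)
    (h : ∀ l ≤ L, Δ * (S.filter fun p => p.2.1 = l).card ≤ c) : Δ * S.card ≤ c * (L + 1) := by
  rw [Finset.card_eq_sum_card_fiberwise (f := fun p : Commit => p.2.1)
    (t := Finset.range (L + 1)) fun p hp => by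
      simp only [Finset.coe_range, Set.mem_Iio]
      exact Nat.lt_succ_of_le (hL p hp), Finset.mul_sum]
  refine (Finset.sum_le_card_nsmul _ _ c fun l hl => h l ?_).trans ?_
  · exact Nat.le_of_lt_succ (Finset.mem_range.1 hl)
  · rw [Finset.card_range, smul_eq_mul, mul_comm]

open Classical in
-- A union bound with weights; with the radii as weights, it turns a bound per request into one by
-- the sum of the radii.
theorem mul_card_filter_exists_le {α β : Type*} (S : Finset α) (T : List β) (P : β → α → Prop)
    (w : β → ℕ) (d c : ℕ) (h : ∀ b ∈ T, d * (S.filter (P b)).card ≤ w b * c) :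
    d * (S.filter fun p => ∃ b ∈ T, P b p).card ≤ (T.map w).sum * c := by
  induction T with
  | nil => simp
  | cons b T ih =>
    have h1 := ih fun b' hb' => h b' (List.mem_cons_of_mem _ hb')
    have h2 := h b List.mem_cons_self
    have h3 : (S.filter fun p => ∃ b' ∈ b :: T, P b' p).card ≤
        (S.filter (P b)).card + (S.filter fun p => ∃ b ∈ T, P b p).card := by
      refine (Finset.card_le_card fun p hp => ?_).trans (Finset.card_union_le _ _)
      simp only [Finset.mem_filter, Finset.mem_union, List.exists_mem_cons_iff] at hp ⊢
      tauto
    calc _ ≤ d * ((S.filter (P b)).card + (S.filter fun p => ∃ b ∈ T, P b p).card) :=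
          Nat.mul_le_mul_left _ h3
      _ ≤ _ := by
        rw [List.map_cons, List.sum_cons, mul_add, add_mul]
        omega

/-- The indices of the intervals that meet a ball of radius `ρ` lie in a short range. -/
theorem mem_Icc_of_meets {n Δ l j w v ρ : ℕ} (hΔ : 0 < Δ) (hw : w ∈ interval n Δ l j)
    (hd : Nat.dist w v ≤ ρ) :
    j ∈ Finset.Icc ((v - ρ) / (Δ * 2 ^ l))
      ((v - ρ) / (Δ * 2 ^ l) + (2 * ρ / (Δ * 2 ^ l) + 2)) := by
  have hD : 0 < Δ * 2 ^ l := by positivity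
  obtain ⟨-, h1, h2⟩ := mem_interval.1 hw
  generalize Δ * 2 ^ l = D at *
  have h3 := Nat.div_add_mod (v - ρ) D
  have h4 := Nat.mod_lt (v - ρ) hD
  have h5 := Nat.div_add_mod (2 * ρ) D
  have h6 := Nat.mod_lt (2 * ρ) hD
  set a := (v - ρ) / D
  set c := 2 * ρ / D
  simp only [Nat.dist] at hd
  rw [Finset.mem_Icc]
  constructor
  · by_contra hc
    have : D * (j + 1) ≤ D * a := Nat.mul_le_mul_left D (by omega)
    rw [mul_add, mul_one] at this
    omega
  · by_contra hc
    have : D * (a + c + 3) ≤ D * j := Nat.mul_le_mul_left D (by omega)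
    rw [mul_add, mul_add] at this
    omega

open Classical in
/-- Few commitments are witnessed by a request with a large radius. -/
theorem mul_card_big_le {n Δ L : ℕ} (hΔ : 0 < Δ) {S : Finset Commit}
    (hL : ∀ p ∈ S, p.2.1 ≤ L) (b : Replica × ℕ) :
    Δ * (S.filter fun p => Witness n Δ b p ∧ p.len Δ ≤ 8 * b.2).card ≤
      b.2 * (26 * (L + 1)) := by
  rw [← mul_assoc]
  refine mul_card_le_of_levels (fun p hp => hL p (Finset.mem_filter.1 hp).1) fun l _ => ?_
  rw [Finset.filter_filter]
  set A := S.filter fun p => (Witness n Δ b p ∧ p.len Δ ≤ 8 * b.2) ∧ p.2.1 = l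
  rcases A.eq_empty_or_nonempty with hA | ⟨p, hp⟩
  · simp [hA]
  have hbig : Δ * 2 ^ l ≤ 8 * b.2 := by
    obtain ⟨-, ⟨-, h⟩, rfl⟩ := Finset.mem_filter.1 hp
    exact h
  set D := Δ * 2 ^ l with hD
  set a := (b.1.1 - b.2) / D
  -- At a fixed level, `b` witnesses only in a window of 2^l times, and for at most 2ρ/D + 3
  -- indices.
  have hsub : A ⊆ (Finset.Ico b.1.2 (b.1.2 + 2 ^ l) ×ˢ
      Finset.Icc a (a + (2 * b.2 / D + 2))).image fun q => (⟨q.1, (l, q.2)⟩ : Commit) := by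
    intro p hp
    obtain ⟨-, ⟨⟨⟨w, hw, hd⟩, h1, h2⟩, -⟩, hl⟩ := Finset.mem_filter.1 hp
    rw [hl] at hw h2
    refine Finset.mem_image.2 ⟨(p.1, p.2.2), Finset.mem_product.2 ⟨?_, ?_⟩, ?_⟩
    · exact Finset.mem_Ico.2 ⟨h1, h2⟩
    · exact mem_Icc_of_meets hΔ hw hd
    · exact Commit.ext rfl hl.symm rfl
  have hcard := (Finset.card_le_card hsub).trans Finset.card_image_le
  rw [Finset.card_product, Nat.card_Ico, Nat.card_Icc] at hcard
  calc Δ * A.card ≤ Δ * (2 ^ l * (2 * b.2 / D + 3)) := by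
        refine Nat.mul_le_mul_left _ (hcard.trans_eq ?_)
        rw [Nat.add_assoc a, Nat.add_sub_cancel_left, Nat.add_sub_cancel_left]
    _ = D * (2 * b.2 / D) + 3 * D := by rw [hD]; ring
    -- The first term is at most 2ρ, and 3D ≤ 24ρ by `hbig`.
    _ ≤ b.2 * 26 := by
        have := Nat.mul_div_le (2 * b.2) D
        omega

/-- The solution `F` has an arc at time `τ` close to the interval of `p`. -/
def HasArc (F : Finset Edge) (Δ : ℕ) (p : Commit) (τ : ℕ) : Prop :=
  ∃ z, Near (p.len Δ) p.2.2 z ∧ Edge.arc z τ ∈ F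

open Classical in
/-- Few commitments have an arc of `F` close to them. -/
theorem card_arc_le {n Δ root m : ℕ} (hΔ : 0 < Δ) {B : Finset Replica} {K : ℕ → Finset (ℕ × ℕ)}
    (hK : ∀ t < m, IsCommitSet n Δ root B t (K t)) (F : Finset Edge) :
    (((Finset.range m).sigma K).filter fun p => HasArc F Δ p p.1).card ≤ 6 * F.card := by
  have hex : ∀ p : Commit, ∃ z, HasArc F Δ p p.1 →
      Near (p.len Δ) p.2.2 z ∧ Edge.arc z p.1 ∈ F := fun p => by
    by_cases h : HasArc F Δ p p.1
    · obtain ⟨z, hz⟩ := h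
      exact ⟨z, fun _ => hz⟩
    · exact ⟨0, fun h' => absurd h' h⟩
  choose z hz using hex
  refine Finset.card_le_mul_card_image_of_maps_to (f := fun p : Commit => Edge.arc (z p) p.1)
    (fun p hp => (hz p (Finset.mem_filter.1 hp).2).2) 6 fun e _ => ?_
  set Φ := (((Finset.range m).sigma K).filter fun p => HasArc F Δ p p.1).filter
    fun p : Commit => Edge.arc (z p) p.1 = e
  rcases Φ.eq_empty_or_nonempty with hΦ | hΦ
  · simp [hΦ]
  -- Compare with a commitment of lowest level in the fiber: one at least two levels higher would
  -- have a neighborhood containing that of `p`, against `not_subset`. Two levels with three indices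
  -- each give 6.
  obtain ⟨p, hp, hmin⟩ := Finset.exists_min_image Φ (fun p => p.2.1) hΦ
  have hmem : ∀ q ∈ Φ, q.1 < m ∧ q.2 ∈ K q.1 ∧ Near (q.len Δ) q.2.2 (z q) ∧
      Edge.arc (z q) q.1 = e := by
    intro q hq
    obtain ⟨hq, he⟩ := Finset.mem_filter.1 hq
    obtain ⟨hq, ha⟩ := Finset.mem_filter.1 hq
    obtain ⟨h1, h2⟩ := Finset.mem_sigma.1 hq
    exact ⟨Finset.mem_range.1 h1, h2, (hz q ha).1, he⟩
  obtain ⟨hp1, hp2, hp3, hp4⟩ := hmem p hp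
  have hsub : Φ ⊆ ((nearIndices (Δ * 2 ^ p.2.1) (z p)).image fun j => (⟨p.1, (p.2.1, j)⟩ : Commit)) ∪
      ((nearIndices (Δ * 2 ^ (p.2.1 + 1)) (z p)).image
        fun j => (⟨p.1, (p.2.1 + 1, j)⟩ : Commit)) := by
    intro q hq
    obtain ⟨hq1, hq2, hq3, hq4⟩ := hmem q hq
    have hle := hmin q hq
    rw [← hp4] at hq4
    obtain ⟨hzq, htq⟩ := Edge.arc.inj hq4
    rw [hzq] at hq3
    rw [htq] at hq2
    have hj : ∀ r : Commit, r.2 ∈ K p.1 → 1 ≤ r.2.2 := by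
      intro r hr
      obtain ⟨_, _, h, _⟩ := (hK p.1 hp1).active _ hr
      exact pos_of_mem_interval h
    have hlt : q.2.1 ≤ p.2.1 + 1 := by
      by_contra hcon
      exact (hK p.1 hp1).not_subset q.2 hq2 p.2 hp2 (by omega)
        (neighborhood_subset_of_near hΔ (hj q hq2) (hj p hp2) (by omega) hq3 hp3)
    have hmn := mem_nearIndices (D := q.len Δ) (by unfold Commit.len; positivity) (Or.inl hq3)
    rw [Finset.mem_union, Finset.mem_image, Finset.mem_image]
    by_cases hl : q.2.1 = p.2.1
    · left
      rw [Commit.len, hl] at hmn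
      exact ⟨q.2.2, hmn, Commit.ext htq.symm hl.symm rfl⟩
    · right
      have hl : q.2.1 = p.2.1 + 1 := by omega
      rw [Commit.len, hl] at hmn
      exact ⟨q.2.2, hmn, Commit.ext htq.symm hl.symm rfl⟩
  refine (Finset.card_le_card hsub).trans ((Finset.card_union_le _ _).trans ?_)
  have h1 := Finset.card_image_le (s := nearIndices (Δ * 2 ^ p.2.1) (z p))
    (f := fun j => (⟨p.1, (p.2.1, j)⟩ : Commit))
  have h2 := Finset.card_image_le (s := nearIndices (Δ * 2 ^ (p.2.1 + 1)) (z p))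
    (f := fun j => (⟨p.1, (p.2.1 + 1, j)⟩ : Commit))
  rw [card_nearIndices] at h1 h2
  omega

/-- The horizontal edge `e` was used by `F` to enter the surroundings of the interval of `p`, and
`F` kept arcs there until a time shortly before `p`. -/
def Charged (F : Finset Edge) (Δ : ℕ) (p : Commit) (e : Edge) : Prop :=
  ∃ x τ, e = .hor x τ ∧ (Near (p.len Δ) p.2.2 x ∨ Near (p.len Δ) p.2.2 (x + 1)) ∧
    ∃ s, τ ≤ s ∧ s ≤ p.1 ∧ p.1 < s + 2 ^ p.2.1 ∧
      ∀ τ', τ ≤ τ' → τ' < s → HasArc F Δ p τ'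

open Classical in
-- The surroundings extend D/4 beyond the interval, and the witnessing request is less than D/8 away
-- from it. A path from the origin, which lies outside, crosses the remaining D/8 at least, on
-- distinct horizontal edges.
theorem len_le_card_charged {n Δ root : ℕ} (hΔ : 0 < Δ) (hr : IsNode n root) {F : Finset Edge}
    {p : Commit} (hp : root ∉ neighborhood n Δ p.2.1 p.2.2) {b : Replica × ℕ}
    (hb : Witness n Δ b p) (hbig : 8 * b.2 < p.len Δ) (hreach : Reach F (root, 0) b.1) :
    p.len Δ ≤ 8 * (F.filter (Charged F Δ p)).card := by
  obtain ⟨⟨w, hw, hd⟩, h1, h2⟩ := hb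
  have hj := pos_of_mem_interval hw
  have hroot : ¬ Near (p.len Δ) p.2.2 root := fun h =>
    hp (mem_neighborhood_of_near hΔ hj hr h)
  obtain ⟨-, h3, h4⟩ := mem_interval.1 hw
  simp only [Nat.dist] at hd
  have hv : Near (p.len Δ) p.2.2 b.1.1 := by
    simp only [Near, Commit.len] at *
    omega
  obtain ⟨y, hy, hx⟩ := hreach.exists_crossing hroot hv
  have hex : ∀ x ∈ Finset.Ico (min y b.1.1) (max y b.1.1),
      ∃ τ, Edge.hor x τ ∈ F.filter (Charged F Δ p) := by
    intro x hxm
    obtain ⟨h5, h6⟩ := Finset.mem_Ico.1 hxm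
    obtain ⟨hM, τ, hτ, hF, harc⟩ := hx x h5 h6
    exact ⟨τ, Finset.mem_filter.2 ⟨hF, x, τ, rfl, hM, b.1.2, hτ, h1, h2, harc⟩⟩
  choose! τ hτ using hex
  have hcard := Finset.card_le_card_of_injOn (fun x => Edge.hor x (τ x)) hτ
    (fun a _ a' _ h => (Edge.hor.inj h).1)
  rw [Nat.card_Ico] at hcard
  simp only [Near, Commit.len] at *
  omega

theorem card_le_of_forall_lt {A : Finset ℕ} {k : ℕ} (h : ∀ a ∈ A, ∀ b ∈ A, b < a + k) :
    A.card ≤ k := by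
  rcases A.eq_empty_or_nonempty with rfl | hA
  · simp
  · have : A ⊆ Finset.Ico (A.min' hA) (A.min' hA + k) := fun b hb =>
      Finset.mem_Ico.2 ⟨A.min'_le b hb, h _ (A.min'_mem hA) b hb⟩
    simpa using Finset.card_le_card this

open Classical in
/-- An edge is charged by few commitments of the same level. -/
theorem card_charging_le {Δ l : ℕ} (hΔ : 0 < Δ) {F : Finset Edge} {S : Finset Commit}
    (hl : ∀ p ∈ S, p.2.1 = l) (hS : ∀ p ∈ S, ¬ HasArc F Δ p p.1) (e : Edge) :
    (S.filter fun p => Charged F Δ p e).card ≤ 2 ^ l * 3 := by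
  rcases e with ⟨x, τ⟩ | ⟨x, τ⟩
  swap
  · rw [Finset.filter_false_of_mem]
    · simp
    · rintro p - ⟨_, _, h, -⟩
      simp at h
  rw [← card_nearIndices (Δ * 2 ^ l) x]
  have hmem : ∀ p ∈ S.filter fun p => Charged F Δ p (.hor x τ), p ∈ S ∧ p.2.1 = l ∧
      (Near (p.len Δ) p.2.2 x ∨ Near (p.len Δ) p.2.2 (x + 1)) ∧
      ∃ s, τ ≤ s ∧ s ≤ p.1 ∧ p.1 < s + 2 ^ l ∧ ∀ τ', τ ≤ τ' → τ' < s → HasArc F Δ p τ' := by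
    intro p hp
    obtain ⟨hp, x', τ', he, h⟩ := Finset.mem_filter.1 hp
    obtain ⟨rfl, rfl⟩ := Edge.hor.inj he
    rw [hl p hp] at h
    exact ⟨hp, hl p hp, h⟩
  refine Finset.card_le_mul_card_image_of_maps_to (f := fun p : Commit => p.2.2) ?_ _ ?_
  · intro p hp
    obtain ⟨-, h1, h2, -⟩ := hmem p hp
    rw [Commit.len, h1] at h2
    exact mem_nearIndices (by positivity) h2
  · intro j _
    set Φ := (S.filter fun p => Charged F Δ p (.hor x τ)).filter fun p => p.2.2 = j
    have hinj : Set.InjOn (fun p : Commit => p.1) Φ := by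
      intro p hp q hq hpq
      obtain ⟨hp1, hp2⟩ := Finset.mem_filter.1 hp
      obtain ⟨hq1, hq2⟩ := Finset.mem_filter.1 hq
      exact Commit.ext hpq ((hmem p hp1).2.1.trans (hmem q hq1).2.1.symm) (hp2.trans hq2.symm)
    rw [← Finset.card_image_of_injOn hinj]
    refine card_le_of_forall_lt fun a ha b hb => ?_
    obtain ⟨p, hp, rfl⟩ := Finset.mem_image.1 ha
    obtain ⟨q, hq, rfl⟩ := Finset.mem_image.1 hb
    obtain ⟨hp1, hp2⟩ := Finset.mem_filter.1 hp
    obtain ⟨hq1, hq2⟩ := Finset.mem_filter.1 hq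
    obtain ⟨hpS, hpl, -, s, h1, h2, h3, h4⟩ := hmem p hp1
    obtain ⟨hqS, hql, -, s', h1', h2', h3', h4'⟩ := hmem q hq1
    -- If `p` came before the request that witnesses `q`, the arcs kept up to that request would
    -- include one near the common interval at time `p.1`, which `hS` excludes. So s' ≤ `p.1`, and
    -- `q.1` is less than `p.1` + 2^l.
    have : ¬ p.1 < s' := fun hlt => by
      obtain ⟨z, hz, hzF⟩ := h4' p.1 (by omega) hlt
      refine hS p hpS ⟨z, ?_, hzF⟩
      rw [Commit.len, hql, hq2] at hz
      rw [Commit.len, hpl, hp2]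
      exact hz
    omega

open Classical in
/-- Few commitments charge horizontal edges of `F`. -/
theorem mul_card_charging_le {Δ L : ℕ} (hΔ : 0 < Δ) {F : Finset Edge} {S : Finset Commit}
    (hL : ∀ p ∈ S, p.2.1 ≤ L) (hS : ∀ p ∈ S, ¬ HasArc F Δ p p.1)
    (hlen : ∀ p ∈ S, p.len Δ ≤ 8 * (F.filter (Charged F Δ p)).card) :
    Δ * S.card ≤ 24 * F.card * (L + 1) := by
  refine mul_card_le_of_levels hL fun l _ => ?_
  set A := S.filter fun p => p.2.1 = l
  have hmem : ∀ p ∈ A, p ∈ S ∧ p.2.1 = l := fun p hp => Finset.mem_filter.1 hp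
  have h1 := Finset.sum_card_bipartiteAbove_eq_sum_card_bipartiteBelow (s := A) (t := F)
    (Charged F Δ)
  have h2 : ∑ e ∈ F, (A.bipartiteBelow (Charged F Δ) e).card ≤ F.card * (2 ^ l * 3) := by
    rw [← smul_eq_mul]
    exact Finset.sum_le_card_nsmul _ _ _ fun e _ =>
      card_charging_le hΔ (fun p hp => (hmem p hp).2) (fun p hp => hS p (hmem p hp).1) e
  have h3 : A.card * (Δ * 2 ^ l) ≤ 8 * ∑ p ∈ A, (F.bipartiteAbove (Charged F Δ) p).card := by
    rw [Finset.mul_sum, ← smul_eq_mul]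
    refine Finset.card_nsmul_le_sum _ _ _ fun p hp => ?_
    have := hlen p (hmem p hp).1
    rwa [Commit.len, (hmem p hp).2] at this
  -- Double counting: each commitment charges at least Δ2^l / 8 edges and each edge is charged at
  -- most 3 · 2^l times. The factor 2^l cancels, so the bound is the same at all levels.
  have h4 : (Δ * A.card) * 2 ^ l ≤ (24 * F.card) * 2 ^ l := by
    calc (Δ * A.card) * 2 ^ l = A.card * (Δ * 2 ^ l) := by ring
      _ ≤ 8 * (F.card * (2 ^ l * 3)) := by omega
      _ = _ := by ring
  exact Nat.le_of_mul_le_mul_right h4 (by positivity)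

/-! ### The competitive ratio -/

theorem IsTrace.exists_witness {n Δ root : ℕ} {h : List Event} {s : State}
    {T : List (Replica × ℕ)} {K : ℕ → Finset (ℕ × ℕ)} (hT : IsTrace n Δ root h s T K) {p : Commit}
    (hp : p ∈ (Finset.range s.time).sigma K) : ∃ b ∈ T, Witness n Δ b p := by
  obtain ⟨h1, h2⟩ := Finset.mem_sigma.1 hp
  obtain ⟨r, hr, hrI, hr1, hr2⟩ := (hT.commit p.1 (Finset.mem_range.1 h1)).active _ h2
  obtain ⟨b, hb, hb1, hb2⟩ := hT.base r hr
  exact ⟨b, hb, ⟨r.1, hrI, (mem_baseNodes.1 hb2).2⟩, hb1 ▸ hr1, hb1 ▸ hr2⟩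

/-- The cost of a run compared with a feasible solution `F`. -/
theorem IsTrace.cost_le {n Δ root : ℕ} (hΔ : 0 < Δ) (hr : IsNode n root) {h : List Event}
    {s : State} {T : List (Replica × ℕ)} {K : ℕ → Finset (ℕ × ℕ)}
    (hT : IsTrace n Δ root h s T K) {F : Finset Edge} (hF : ∀ e ∈ F, IsEdge n e)
    (hreach : ∀ b ∈ T, Reach F (root, 0) b.1) :
    ∃ c, s.sol.card ≤ (4 * Δ + 3) * F.card + s.time + 6 * F.card + c ∧
      Δ * c ≤ 50 * F.card * (topLevel n Δ + 1) := by
  classical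
  have hsum := sum_radius_le_card hF T hT.pairwise fun b hb => ⟨hreach b hb, hT.origin b hb⟩
  set L := topLevel n Δ
  set S : Finset Commit := (Finset.range s.time).sigma K
  have hS : ∀ p ∈ S, IsCommitSet n Δ root s.base p.1 (K p.1) ∧ p.2 ∈ K p.1 := by
    intro p hp
    obtain ⟨h1, h2⟩ := Finset.mem_sigma.1 hp
    exact ⟨hT.commit p.1 (Finset.mem_range.1 h1), h2⟩
  have hL : ∀ p ∈ S, p.2.1 ≤ L := fun p hp => (hS p hp).1.level _ (hS p hp).2
  -- `A`: a large witnessing radius. `B`: an arc of `F` nearby. `C`: the rest, charged to horizontal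
  -- edges. `B` costs 6 per edge of `F` outright; `A` and `C` carry the factor (L + 1)/Δ, with
  -- constant 26 + 24 = 50.
  set A := S.filter fun p => ∃ b ∈ T, Witness n Δ b p ∧ p.len Δ ≤ 8 * b.2 with hA
  set B := S.filter fun p => HasArc F Δ p p.1 with hB
  set C := (S \ A) \ B with hC
  have hAc : Δ * A.card ≤ (T.map Prod.snd).sum * (26 * (L + 1)) := by
    convert mul_card_filter_exists_le S T (fun b p => Witness n Δ b p ∧ p.len Δ ≤ 8 * b.2)
      Prod.snd Δ (26 * (L + 1)) fun b _ => by
        convert mul_card_big_le (n := n) hΔ hL b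
  have hBc : B.card ≤ 6 * F.card := card_arc_le hΔ hT.commit F
  have hCc : Δ * C.card ≤ 24 * F.card * (L + 1) := by
    have hmem : ∀ p ∈ C, p ∈ S ∧ p ∉ A ∧ p ∉ B := by
      intro p hp
      simp only [hC, Finset.mem_sdiff] at hp
      tauto
    refine mul_card_charging_le hΔ (fun p hp => hL p (hmem p hp).1)
      (fun p hp harc => (hmem p hp).2.2 (Finset.mem_filter.2 ⟨(hmem p hp).1, harc⟩))
      fun p hp => ?_
    obtain ⟨hpS, hpA, -⟩ := hmem p hp
    obtain ⟨b, hb, hw⟩ := hT.exists_witness hpS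
    refine len_le_card_charged hΔ hr ((hS p hpS).1.root_notMem _ (hS p hpS).2) hw ?_
      (hreach b hb)
    by_contra hcon
    exact hpA (Finset.mem_filter.2 ⟨hpS, b, hb, hw, by omega⟩)
  have hSc : S.card ≤ A.card + B.card + C.card := by
    have h1 : S.card ≤ (S \ A).card + A.card := Finset.card_le_card_sdiff_add_card
    have h2 : (S \ A).card ≤ C.card + B.card := Finset.card_le_card_sdiff_add_card
    omega
  refine ⟨A.card + C.card, ?_, ?_⟩
  · have h1 := hT.cost
    rw [Finset.sum_add_distrib, Finset.sum_const, Finset.card_range, smul_eq_mul, mul_one,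
      ← Finset.card_sigma] at h1
    have h2 : (4 * Δ + 3) * (T.map Prod.snd).sum ≤ (4 * Δ + 3) * F.card :=
      Nat.mul_le_mul_left _ hsum
    change _ ≤ _ + (_ + S.card) at h1
    omega
  · have h3 : (T.map Prod.snd).sum * (26 * (L + 1)) ≤ F.card * (26 * (L + 1)) :=
      Nat.mul_le_mul_right _ hsum
    calc Δ * (A.card + C.card) = Δ * A.card + Δ * C.card := by ring
      _ ≤ F.card * (26 * (L + 1)) + 24 * F.card * (L + 1) := by omega
      _ = _ := by ring

theorem lineOn_competitive {n Δ root : ℕ} (hΔ : 0 < Δ) (hr : IsNode n root) (σ : TieBreaking)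
    {R : List Replica} (hR : IsRequestSeq n R) :
    Feasible n root R (lineOn n Δ root σ (events R)) ∧
    ∃ c, (lineOn n Δ root σ (events R)).card ≤
        (4 * Δ + 11) * max (opt n root R) 1 + c ∧
      Δ * c ≤ 50 * max (opt n root R) 1 * (topLevel n Δ + 1) := by
  have hv := validHistory_events hR.1
  obtain ⟨h1, h2⟩ := lineOn_reach hΔ hr σ hv
  have hfeas : Feasible n root R (lineOn n Δ root σ (events R)) :=
    ⟨h1, fun r hrR => h2 r (mem_timed_events.2 hrR)⟩
  refine ⟨hfeas, ?_⟩
  obtain ⟨F, hF, hopt⟩ : ∃ F, Feasible n root R F ∧ F.card = opt n root R :=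
    -- The optimum is attained because the solution of LineOn itself shows that feasible solutions
    -- exist.
    Nat.sInf_mem (s := {k | ∃ F : Finset Edge, Feasible n root R F ∧ F.card = k})
      ⟨_, _, hfeas, rfl⟩
  obtain ⟨T, K, hT⟩ := exists_isTrace hΔ hr σ hv
  have hreach : ∀ b ∈ T, Reach F (root, 0) b.1 := fun b hb =>
    hF.2 _ (mem_timed_events.1 (hT.requests ▸ List.mem_map_of_mem hb))
  obtain ⟨c, hc1, hc2⟩ := hT.cost_le hΔ hr hF.1 hreach
  have htime : (run n Δ root σ (events R)).time = lastTime R + 1 := by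
    rw [run_time]
    exact currentTime_eventsBefore R _
  have hlast : lastTime R ≤ F.card := lastTime_le fun r hrR => (hF.2 r hrR).time_le_card
  rw [← hopt]
  have hmax : F.card ≤ max F.card 1 := le_max_left _ _
  have hmax1 : 1 ≤ max F.card 1 := le_max_right _ _
  refine ⟨c, ?_, hc2.trans ?_⟩
  · change (run n Δ root σ (events R)).sol.card ≤ _
    have : (4 * Δ + 3) * F.card ≤ (4 * Δ + 3) * max F.card 1 := Nat.mul_le_mul_left _ hmax
    -- Here 8 = 6 + 2: 6 for commitments near arcs of `F`, and 2 for the number of time steps, which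
    -- is at most `F.card` + 1.
    have h3 : (4 * Δ + 11) * max F.card 1 = (4 * Δ + 3) * max F.card 1 + 8 * max F.card 1 := by
      ring
    omega
  · gcongr

/-- Rounding up and counting level 0 add at most 2, and the logarithm is at least 1. -/
theorem topLevel_le_logb {n Δ : ℕ} (hn : 2 ≤ n) (hΔ : 0 < Δ) :
    (topLevel n Δ : ℝ) + 1 ≤ 3 * logb 2 n := by
  have h1 : topLevel n Δ ≤ Nat.clog 2 n := by
    refine Nat.clog_mono_right 2 ((ceilDiv_le_iff_le_mul hΔ).2 ?_)
    exact Nat.le_mul_of_pos_left n hΔ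
  have h2 : Nat.clog 2 n ≤ Nat.log 2 n + 1 := by
    refine Nat.clog_le_of_le_pow ?_
    exact (Nat.lt_pow_succ_log_self (by norm_num) n).le
  have h3 : (Nat.log 2 n : ℝ) ≤ logb 2 n := by
    simpa using Real.natLog_le_logb n 2
  have h4 : 1 ≤ Nat.log 2 n := by
    exact Nat.log_pos (by norm_num) hn
  have h5 : (topLevel n Δ : ℝ) ≤ Nat.log 2 n + 1 := by exact_mod_cast h1.trans h2
  have h6 : (1 : ℝ) ≤ Nat.log 2 n := by exact_mod_cast h4
  linarith

theorem one_le_logb {n : ℕ} (hn : 2 ≤ n) : 1 ≤ logb 2 n := by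
  rw [Real.le_logb_iff_rpow_le (by norm_num) (by positivity)]
  simpa using hn

end MCD

/-! ### Balancing the parameter and the final constant -/

theorem mainTheorem1 :
    ∃ K : ℝ, 0 < K ∧ ∀ n root : ℕ, 2 ≤ n → MCD.IsNode n root → ∀ σ : MCD.TieBreaking,
      MCD.IsOnlineAlgorithm n root (MCD.lineOn n (MCD.delta n) root σ) ∧
      MCD.IsCompetitive n root (MCD.lineOn n (MCD.delta n) root σ)
        (K * Real.sqrt (Real.logb 2 n)) := by
  refine ⟨200, by norm_num, fun n root hn hr σ => ?_⟩
  have hlog := MCD.one_le_logb hn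
  set x := Real.sqrt (Real.logb 2 n) with hx
  have hx1 : 1 ≤ x := Real.one_le_sqrt.2 hlog
  have hxx : x * x = Real.logb 2 n := Real.mul_self_sqrt (by linarith)
  have hsqrt : Real.sqrt (10 * Real.logb 2 n) = Real.sqrt 10 * x :=
    Real.sqrt_mul (by norm_num) _
  have h10 : 3 ≤ Real.sqrt 10 := Real.le_sqrt_of_sq_le (by norm_num)
  have h10' : Real.sqrt 10 ≤ 4 := Real.sqrt_le_iff.2 (by norm_num)
  -- Of the parameter only 3x ≤ Δ ≤ 5x is used: the upper bound controls deliveries, the lower bound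
  -- commitments.
  have hlow : 3 * x ≤ MCD.delta n := by
    refine le_trans ?_ (Nat.le_ceil _)
    rw [hsqrt]
    gcongr
  have hup : (MCD.delta n : ℝ) ≤ 5 * x := by
    refine (Nat.ceil_lt_add_one (Real.sqrt_nonneg _)).le.trans ?_
    rw [hsqrt]
    nlinarith
  have hΔ : 0 < MCD.delta n := by
    have : (0 : ℝ) < MCD.delta n := by linarith
    exact_mod_cast this
  refine ⟨MCD.isOnlineAlgorithm_lineOn hΔ hr σ, fun R hR => ?_⟩
  obtain ⟨hfeas, c, hc1, hc2⟩ := MCD.lineOn_competitive hΔ hr σ hR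
  refine ⟨hfeas, ?_⟩
  have hL := MCD.topLevel_le_logb hn hΔ
  set Δ := MCD.delta n
  set m := max (MCD.opt n root R) 1
  have hc1' : ((MCD.lineOn n Δ root σ (MCD.events R)).card : ℝ) ≤ (4 * Δ + 11) * m + c := by
    exact_mod_cast hc1
  have hc2' : (Δ : ℝ) * c ≤ 50 * m * (MCD.topLevel n Δ + 1) := by exact_mod_cast hc2
  have hm : (0 : ℝ) ≤ m := Nat.cast_nonneg m
  have hcx : (c : ℝ) ≤ 50 * m * x := by
    -- The number of levels is at most 3x², and dividing by Δ ≥ 3x leaves one factor x.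
    have h1 : 3 * x * c ≤ 3 * x * (50 * m * x) := by
      calc 3 * x * c ≤ Δ * c := by gcongr
        _ ≤ 50 * m * (MCD.topLevel n Δ + 1) := hc2'
        _ ≤ 50 * m * (3 * Real.logb 2 n) := by gcongr
        _ = 3 * x * (50 * m * x) := by rw [← hxx]; ring
    exact le_of_mul_le_mul_left h1 (by linarith)
  calc _ ≤ (4 * (Δ : ℝ) + 11) * m + c := hc1'
    _ ≤ (4 * (5 * x) + 11 * x) * m + 50 * m * x := by gcongr; linarith
    -- 81 = 20 + 11 + 50; the constant 200 is not tight.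
    _ = 81 * x * m := by ring
    _ ≤ 200 * x * m := by gcongr; norm_num
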